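/- Let $T>0$, $d,m\ge 1$ be integers, $\zeta_1,\dots,\zeta_m\in\mathbf R^d$ and $\alpha_1,\dots,\alpha_m\in\mathbf R$. For every integer $n\ge 1$, let $\mathcal N^n_1,\dots,\mathcal N^n_m$ be independent Poisson random measures on $[0,T]\times\mathbf R_+$, $\mathcal N^n_k$ having intensity $n^{\alpha_k}\,ds\otimes dz$, with respect to some filtration $(\mathcal F^n_t)$ (that is, their restrictions to times in $[0,t]$ are $\mathcal F^n_t$-measurable, and their restrictions to times after $t$ are jointly independent of $\mathcal F^n_t$). Let $\rho^n_1,\dots,\rho^n_m$ be real functionals of a time $t\in[0,T]$ and a right-continuous path with left limits (rcll) from $[0,T]$ to $\mathbf R^d$, and let $\overline X_n$ be an adapted rcll $\mathbf R^d$-valued process on $[0,T]$, along which the jump rates $\rho^n_k(t,n\overline X_n)$ are nonnegative, such that almost surely, for all $t\in[0,T]$, $$\overline X_n(t)=\overline X_n(0)+\frac1n\sum_{k=1}^m\left(\int_0^t\int_{\mathbf R_+}\mathbf 1_{\{z\le\rho^n_k(s,n\overline X_n)\}}\,d\mathcal N^n_k(s,z)\right)\zeta_k .$$ Suppose that for every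 $k$ there are a function $r_k:[0,T]\times\mathbf R^d\to\mathbf R$, measurable in $t$ and Lipschitz in $x$ with a constant that does not depend on $t$, and a constant $K_k$, both independent of $n$, such that for all $n\ge1$, all $t\in(0,T]$ and all rcll paths $w$, $$n^{\alpha_k-1}\rho^n_k(t,nw)=r_k(t,w(t^-)),\qquad\text{and}\qquad \sup_{n\ge1}\mathbf E\Big[\sup_{t\le T}|r_k(t,\overline X_n(t))|\Big]\le K_k .$$ Suppose moreover that $\Lambda:[0,T]\to\mathbf R^d$ is a continuous solution of $$\Lambda(t)=\Lambda(0)+\sum_{k=1}^m\left(\int_0^t r_k(s,\Lambda(s))\,ds\right)\zeta_k,\qquad t\in[0,T].$$ Then there exist constants $c>0$ and $K\ge0$, independent of $n$, such that $$\sup_{n\ge1}\mathbf E\Big[\sup_{t\le T}\|\overline X_n(t)\|\Big]\le e^{cT}\quad\text{provided that } \sup_{n\ge1}\mathbf E\|\overline X_n(0)\|<\infty,$$ and, for all $n\ge1$, $$\mathbf E\Big[\sup_{t\le T}\|\overline X_n(t)-\Lambda(t)\|\Big]\le\Big(\mathbf E\|\overline X_n(0)-\Lambda(0)\|+K n^{-1/2}\Big)e^{cT}.$$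 -/

import Mathlib

open MeasureTheory ProbabilityTheory Filter Topology Set
open scoped NNReal ENNReal

/-- A random measure `N` on `S` is a Poisson random measure with intensity `ν`:
`N A` is a Poisson variable of parameter `ν A` for every measurable `A` with `ν A < ∞`, and
the values of `N` on pairwise disjoint measurable sets are independent. -/
structure IsPoissonRandomMeasure {Ω S : Type*} [MeasurableSpace Ω] [MeasurableSpace S]
    (P : Measure Ω) (ν : Measure S) (N : Ω → Measure S) : Prop where
  measurable : Measurable N
  law : ∀ A : Set S, MeasurableSet A → ν A ≠ ∞ →
    P.map (fun ω => N ω A) = (poissonMeasure (ν A).toNNReal).map (fun j : ℕ => (j : ℝ≥0∞))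
  indep : ∀ (l : ℕ) (A : Fin l → Set S), (∀ i, MeasurableSet (A i)) →
    Pairwise (fun i j => Disjoint (A i) (A j)) → iIndepFun (fun i ω => N ω (A i)) P

/-- The `N k` are independent Poisson random measures on (time) × (marks), with respective
intensities `ν k`, relative to the filtration `F`: the restrictions to `(-∞, t] × ℝ` are
`F t`-measurable, and the restrictions to `(t, ∞) × ℝ` are jointly independent of `F t`. -/
structure IsPoissonFamily {Ω : Type*} [mΩ : MeasurableSpace Ω] {m : ℕ} (P : Measure Ω)
    (F : Filtration ℝ mΩ) (ν : Fin m → Measure (ℝ × ℝ)) (N : Fin m → Ω → Measure (ℝ × ℝ)) :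
    Prop where
  poisson : ∀ k, IsPoissonRandomMeasure P (ν k) (N k)
  indep : iIndepFun N P
  adapted : ∀ k, ∀ t : ℝ, 0 ≤ t →
    Measurable[F t] (fun ω => (N k ω).restrict (Iic t ×ˢ univ))
  indep_future : ∀ t : ℝ, 0 ≤ t →
    Indep (⨆ k, MeasurableSpace.comap (fun ω => (N k ω).restrict (Ioi t ×ˢ univ)) inferInstance)
      (F t) P

/-- The measure `a ds ⊗ dz` on `[0, T] × ℝ₊`. -/
noncomputable def intensity (T a : ℝ) : Measure (ℝ × ℝ) :=
  ENNReal.ofReal a • ((volume : Measure ℝ).restrict (Icc 0 T)).prod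
    ((volume : Measure ℝ).restrict (Ici 0))

/-- Right continuous with left limits on `[0, T]`; the values off `[0, T]` are irrelevant. -/
def IsRcll {E : Type*} [TopologicalSpace E] (T : ℝ) (w : ℝ → E) : Prop :=
  (∀ t ∈ Ico 0 T, ContinuousWithinAt w (Ici t) t) ∧
    ∀ t ∈ Ioc 0 T, ∃ l, Tendsto w (𝓝[<] t) (𝓝 l)

/-- The points `(s, z)` with `0 < s ≤ t` and `0 ≤ z ≤ φ s`; the `M`-measure of this set is
`∫₀ᵗ ∫_{ℝ₊} 1_{z ≤ φ s} dM(s, z)`. -/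
def underGraph (φ : ℝ → ℝ) (t : ℝ) : Set (ℝ × ℝ) :=
  {p | 0 < p.1 ∧ p.1 ≤ t ∧ 0 ≤ p.2 ∧ p.2 ≤ φ p.1}

/-- `Y` is the scaled process of index `n`: an adapted rcll process on `[0, T]` which solves
`Y t = Y 0 + n⁻¹ ∑ k, (∫₀ᵗ ∫_{ℝ₊} 1_{z ≤ ρ k (s, n Y)} dN k (s, z)) ζ k`, where the `N k` are
independent Poisson measures of intensities `n ^ α k ds ⊗ dz`. The `ρ k`, evaluated along the
process, are jump rates, hence nonnegative. -/
structure IsScaledProcess {Ω E : Type*} [mΩ : MeasurableSpace Ω] [NormedAddCommGroup E]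
    [NormedSpace ℝ E] [MeasurableSpace E] {m : ℕ} (P : Measure Ω) (T : ℝ) (ζ : Fin m → E)
    (α : Fin m → ℝ) (n : ℕ) (ρ : Fin m → ℝ → (ℝ → E) → ℝ) (F : Filtration ℝ mΩ)
    (N : Fin m → Ω → Measure (ℝ × ℝ)) (Y : ℝ → Ω → E) : Prop where
  poisson : IsPoissonFamily P F (fun k => intensity T ((n : ℝ) ^ α k)) N
  adapted : ∀ t ∈ Icc 0 T, Measurable[F t] (Y t)
  rcll : ∀ ω, IsRcll T (fun t => Y t ω)
  rate_nonneg : ∀ᵐ ω ∂P, ∀ k, ∀ t ∈ Ioc 0 T, 0 ≤ ρ k t (fun u => (n : ℝ) • Y u ω)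
  finite : ∀ᵐ ω ∂P, ∀ k, N k ω (underGraph (fun s => ρ k s (fun u => (n : ℝ) • Y u ω)) T) ≠ ∞
  sde : ∀ᵐ ω ∂P, ∀ t ∈ Icc 0 T, Y t ω = Y 0 ω + (n : ℝ)⁻¹ •
    ∑ k, (N k ω (underGraph (fun s => ρ k s (fun u => (n : ℝ) • Y u ω)) t)).toReal • ζ k

/-- The law of large numbers scaling: along every rcll path, `n ^ (α k - 1) ρ k (t, n w)` is
`r k (t, w (t-))` with `r k` independent of `n` and Lipschitz in space uniformly in time, and
`E [sup_{t ≤ T} |r k (t, X n t)|] ≤ κ k` for all `n ≥ 1`. -/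
structure LLNScaling {Ω E : Type*} [MeasurableSpace Ω] [NormedAddCommGroup E] [NormedSpace ℝ E]
    {m : ℕ} (P : Measure Ω) (T : ℝ) (α : Fin m → ℝ) (ρ : ℕ → Fin m → ℝ → (ℝ → E) → ℝ)
    (r : Fin m → ℝ → E → ℝ) (L κ : Fin m → ℝ≥0) (X : ℕ → ℝ → Ω → E) : Prop where
  measurable : ∀ k x, Measurable (fun t => r k t x)
  lipschitz : ∀ k, ∀ t ∈ Icc 0 T, LipschitzWith (L k) (r k t)
  scaling : ∀ n : ℕ, 1 ≤ n → ∀ k, ∀ w : ℝ → E, IsRcll T w → ∀ t ∈ Ioc 0 T,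
    (n : ℝ) ^ (α k - 1) * ρ n k t (fun u => (n : ℝ) • w u) = r k t (Function.leftLim w t)
  bound : ∀ n : ℕ, 1 ≤ n → ∀ k, ∫⁻ ω, ⨆ t ∈ Icc 0 T, ‖r k t (X n t ω)‖ₑ ∂P ≤ κ k

/-- `Λ` is a continuous solution on `[0, T]` of
`Λ t = Λ 0 + ∑ k, (∫₀ᵗ r k (s, Λ s) ds) ζ k`. -/
structure IsFluidLimit {E : Type*} [NormedAddCommGroup E] [NormedSpace ℝ E] {m : ℕ} (T : ℝ)
    (ζ : Fin m → E) (r : Fin m → ℝ → E → ℝ) (Λ : ℝ → E) : Prop where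
  continuousOn : ContinuousOn Λ (Icc 0 T)
  integrable : ∀ k, IntervalIntegrable (fun s => r k s (Λ s)) volume 0 T
  eq : ∀ t ∈ Icc 0 T, Λ t = Λ 0 + ∑ k, (∫ s in (0 : ℝ)..t, r k s (Λ s)) • ζ k

/-! The scaling says that the `k`-th rate along the process is `n ^ (1 - α k) * r k (s, X(s-))`, so
the region under its graph has intensity `n ∫ r k (s, X s) ds`. Each jump term is therefore the
drift of the fluid equation plus `n⁻¹ W`, with `W` the compensated Poisson measure of a random
region. This region is predictable, because the rate sees the path only through its left limit. On
predictable sets `W` is centred and satisfies the isometry `E [W(H)²] = E [ν(H)]`. Hence `t ↦ W(H ∩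
{time ≤ t})` is a martingale (first inside sets of finite intensity, then in the limit), here with
variance of order `n`. Doob's inequality bounds the mean of its maximum by a multiple of `√n`, and
division by `n` leaves `n ^ (-1/2)`.

The rest is deterministic. Subtracting the fluid equation and using the Lipschitz bound, Grönwall's
lemma controls the deviation on each path by the initial deviation and the martingale maxima; then
one takes expectations. The moment bound follows because `Λ` is bounded on `[0, T]` and `c` may be
enlarged.

The carrying lemmas are `integral_compensated_sq` (isometry), `lintegral_iSup_dyadic_compensated_le`
(maximal inequality), `measurableSet_rateRegion` (predictability) and `norm_sub_le_of_dyadic`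
(pathwise estimate). -/

/-! ### Moments of the Poisson law -/

section PoissonMoments

/-- The weights satisfy `n * p n = r * p (n - 1)`. Taking `g = 1` and `g n = n + 1` yields the first
two moments; the truncated `n - 1` at `n = 0` is harmless because of the factor `n`. -/
theorem hasSum_poisson_shift (r : ℝ≥0) {g : ℕ → ℝ} {S : ℝ}
    (h : HasSum (fun n : ℕ => Real.exp (-r) * (r : ℝ) ^ n / n.factorial * g n) S) :
    HasSum (fun n : ℕ => Real.exp (-r) * (r : ℝ) ^ n / n.factorial * (n * g (n - 1))) (r * S) := by
  rw [← hasSum_nat_add_iff' 1]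
  simp only [Finset.range_one, Finset.sum_singleton, CharP.cast_eq_zero, zero_mul, mul_zero,
    sub_zero, Nat.add_sub_cancel]
  refine (h.mul_left (r : ℝ)).congr_fun fun n => ?_
  rw [Nat.factorial_succ]
  push_cast
  field_simp
  ring

theorem hasSum_poisson_mean (r : ℝ≥0) :
    HasSum (fun n : ℕ => Real.exp (-r) * (r : ℝ) ^ n / n.factorial * n) r := by
  have h := hasSum_poisson_shift r (g := fun _ => 1) (S := 1)
    (by simpa using hasSum_one_poissonMeasure r)
  simpa using h

theorem hasSum_poisson_sq (r : ℝ≥0) :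
    HasSum (fun n : ℕ => Real.exp (-r) * (r : ℝ) ^ n / n.factorial * (n : ℝ) ^ 2)
      (r * (r + 1)) := by
  have h := hasSum_poisson_shift r (g := fun n => n + 1) (S := r + 1) (by
    simpa [mul_add] using (hasSum_poisson_mean r).add (hasSum_one_poissonMeasure r))
  refine h.congr_fun fun n => ?_
  rcases n with _ | n
  · simp
  · push_cast [Nat.add_sub_cancel]
    ring

theorem integrable_sq_poissonMeasure (r : ℝ≥0) :
    Integrable (fun n : ℕ => (n : ℝ) ^ 2) (poissonMeasure r) := by
  rw [integrable_poissonMeasure_iff]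
  simpa using (hasSum_poisson_sq r).summable

theorem memLp_two_poissonMeasure (r : ℝ≥0) :
    MemLp (fun n : ℕ => (n : ℝ)) 2 (poissonMeasure r) :=
  (memLp_two_iff_integrable_sq .of_discrete).2 (integrable_sq_poissonMeasure r)

theorem integral_id_poissonMeasure (r : ℝ≥0) :
    ∫ n : ℕ, (n : ℝ) ∂(poissonMeasure r) = r := by
  rw [integral_poissonMeasure]
  simpa using (hasSum_poisson_mean r).tsum_eq

theorem integral_sq_poissonMeasure (r : ℝ≥0) :
    ∫ n : ℕ, (n : ℝ) ^ 2 ∂(poissonMeasure r) = r * (r + 1) := by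
  rw [integral_poissonMeasure]
  simpa using (hasSum_poisson_sq r).tsum_eq

end PoissonMoments

/-! ### Mean and covariance of a Poisson random measure -/

namespace IsPoissonRandomMeasure

variable {Ω S : Type*} [MeasurableSpace Ω] [MeasurableSpace S] {P : Measure Ω}
  {ν : Measure S} {N : Ω → Measure S} {C D : Set S}

theorem measurable_real (h : IsPoissonRandomMeasure P ν N) (hC : MeasurableSet C) :
    Measurable fun ω => (N ω).real C :=
  ((Measure.measurable_coe hC).comp h.measurable).ennreal_toReal

theorem ae_ne_top (h : IsPoissonRandomMeasure P ν N) (hC : MeasurableSet C) (hν : ν C ≠ ∞) :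
    ∀ᵐ ω ∂P, N ω C ≠ ∞ := by
  have hm : Measurable fun ω => N ω C := (Measure.measurable_coe hC).comp h.measurable
  have : ∀ᵐ x ∂(P.map fun ω => N ω C), x ≠ ∞ := by
    rw [h.law C hC hν]
    exact (ae_map_iff (p := fun x => x ≠ ∞) (by fun_prop) (measurableSet_singleton _).compl).2
      (ae_of_all _ fun n => by simp)
  exact ae_of_ae_map hm.aemeasurable this

theorem map_real (h : IsPoissonRandomMeasure P ν N) (hC : MeasurableSet C) (hν : ν C ≠ ∞) :
    P.map (fun ω => (N ω).real C) =
      (poissonMeasure (ν C).toNNReal).map (fun n : ℕ => (n : ℝ)) := by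
  have hm : Measurable fun ω => N ω C := (Measure.measurable_coe hC).comp h.measurable
  have e : (fun ω => (N ω).real C) = ENNReal.toReal ∘ fun ω => N ω C := rfl
  rw [e, ← Measure.map_map ENNReal.measurable_toReal hm, h.law C hC hν,
    Measure.map_map ENNReal.measurable_toReal (by fun_prop)]
  congr 1

theorem memLp_two_real (h : IsPoissonRandomMeasure P ν N) (hC : MeasurableSet C)
    (hν : ν C ≠ ∞) : MemLp (fun ω => (N ω).real C) 2 P := by
  have h2 : MemLp (id : ℝ → ℝ) 2 (P.map (fun ω => (N ω).real C)) := by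
    rw [h.map_real hC hν, memLp_map_measure_iff (by fun_prop) (by fun_prop)]
    exact memLp_two_poissonMeasure _
  exact (memLp_map_measure_iff (by fun_prop) (h.measurable_real hC).aemeasurable).1 h2

theorem integral_real (h : IsPoissonRandomMeasure P ν N) (hC : MeasurableSet C)
    (hν : ν C ≠ ∞) : ∫ ω, (N ω).real C ∂P = ν.real C := by
  have := integral_map (μ := P) (h.measurable_real hC).aemeasurable (f := fun x : ℝ => x)
    (by fun_prop)
  rw [← this, h.map_real hC hν, integral_map (by fun_prop) (by fun_prop),
    integral_id_poissonMeasure]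
  rfl

theorem integral_real_sq (h : IsPoissonRandomMeasure P ν N) (hC : MeasurableSet C)
    (hν : ν C ≠ ∞) : ∫ ω, (N ω).real C ^ 2 ∂P = ν.real C * (ν.real C + 1) := by
  have := integral_map (μ := P) (h.measurable_real hC).aemeasurable (f := fun x : ℝ => x ^ 2)
    (by fun_prop)
  rw [← this, h.map_real hC hν, integral_map (by fun_prop) (by fun_prop),
    integral_sq_poissonMeasure]
  rfl

variable [IsProbabilityMeasure P]

theorem memLp_two_sub (h : IsPoissonRandomMeasure P ν N) (hC : MeasurableSet C)
    (hν : ν C ≠ ∞) : MemLp (fun ω => (N ω).real C - ν.real C) 2 P :=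
  (h.memLp_two_real hC hν).sub (memLp_const _)

theorem integral_sub_eq_zero (h : IsPoissonRandomMeasure P ν N) (hC : MeasurableSet C)
    (hν : ν C ≠ ∞) : ∫ ω, ((N ω).real C - ν.real C) ∂P = 0 := by
  rw [integral_sub ((h.memLp_two_real hC hν).integrable (by norm_num)) (integrable_const _),
    h.integral_real hC hν]
  simp

theorem integral_sub_sq (h : IsPoissonRandomMeasure P ν N) (hC : MeasurableSet C)
    (hν : ν C ≠ ∞) : ∫ ω, ((N ω).real C - ν.real C) ^ 2 ∂P = ν.real C := by
  have h2 := h.memLp_two_real hC hν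
  have e : ∀ ω, ((N ω).real C - ν.real C) ^ 2 =
      (N ω).real C ^ 2 - (2 * ν.real C * (N ω).real C - ν.real C ^ 2) := fun ω => by ring
  have hi : Integrable (fun ω => 2 * ν.real C * (N ω).real C) P :=
    (h2.integrable (by norm_num)).const_mul _
  simp_rw [e]
  have hi' : Integrable (fun ω => 2 * ν.real C * (N ω).real C - ν.real C ^ 2) P :=
    hi.sub (integrable_const _)
  rw [integral_sub h2.integrable_sq hi', integral_sub hi (integrable_const _), integral_const_mul, h.integral_real hC hν,
    h.integral_real_sq hC hν]
  simp
  ring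

theorem integral_sub_mul_sub_of_disjoint (h : IsPoissonRandomMeasure P ν N)
    (hC : MeasurableSet C) (hνC : ν C ≠ ∞) (hD : MeasurableSet D)
    (hCD : Disjoint C D) :
    ∫ ω, ((N ω).real C - ν.real C) * ((N ω).real D - ν.real D) ∂P = 0 := by
  have hi : IndepFun (fun ω => N ω C) (fun ω => N ω D) P := by
    have := (h.indep 2 ![C, D] (by intro i; fin_cases i <;> simpa)
      (by
        intro i j hij
        fin_cases i <;> fin_cases j <;> first | exact absurd rfl hij | simpa using hCD |
          simpa using hCD.symm)).indepFun (i := 0) (j := 1) (by decide)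
    simpa using this
  have hi2 : IndepFun (fun ω => (N ω).real C - ν.real C) (fun ω => (N ω).real D - ν.real D) P :=
    hi.comp (φ := fun x : ℝ≥0∞ => x.toReal - ν.real C) (ψ := fun x : ℝ≥0∞ => x.toReal - ν.real D)
      (by fun_prop) (by fun_prop)
  rw [hi2.integral_fun_mul_eq_mul_integral
    ((h.measurable_real hC).sub_const _).aestronglyMeasurable
    ((h.measurable_real hD).sub_const _).aestronglyMeasurable,
    h.integral_sub_eq_zero hC hνC, zero_mul]

/-- The covariance of the values of a Poisson random measure on two sets is the intensity of
their intersection. -/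
theorem integral_sub_mul_sub (h : IsPoissonRandomMeasure P ν N)
    (hC : MeasurableSet C) (hνC : ν C ≠ ∞) (hD : MeasurableSet D) (hνD : ν D ≠ ∞) :
    ∫ ω, ((N ω).real C - ν.real C) * ((N ω).real D - ν.real D) ∂P = ν.real (C ∩ D) := by
  have hνI : ν (C ∩ D) ≠ ∞ := measure_ne_top_of_subset inter_subset_left hνC
  have hνC' : ν (C \ D) ≠ ∞ := measure_ne_top_of_subset sdiff_subset hνC
  have hνD' : ν (D \ C) ≠ ∞ := measure_ne_top_of_subset sdiff_subset hνD
  have mI := hC.inter hD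
  have mC := hC.diff hD
  have mD := hD.diff hC
  -- Both sets are cut along `C ∩ D`. Only the square of the common part survives, since disjoint
  -- pieces are independent and centred.
  have e : (fun ω => ((N ω).real C - ν.real C) * ((N ω).real D - ν.real D)) =ᵐ[P] fun ω =>
      ((N ω).real (C ∩ D) - ν.real (C ∩ D)) ^ 2
      + ((N ω).real (C ∩ D) - ν.real (C ∩ D)) * ((N ω).real (D \ C) - ν.real (D \ C))
      + ((N ω).real (C \ D) - ν.real (C \ D)) * ((N ω).real D - ν.real D) := by
    filter_upwards [h.ae_ne_top hC hνC, h.ae_ne_top hD hνD] with ω h1 h2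
    rw [← measureReal_inter_add_sdiff (μ := N ω) hD h1, ← measureReal_inter_add_sdiff hD hνC,
      ← measureReal_inter_add_sdiff (μ := N ω) (s := D) hC h2,
      ← measureReal_inter_add_sdiff (s := D) hC hνD, inter_comm D C]
    ring
  have i1 := (h.memLp_two_sub mI hνI).integrable_sq
  have i2 : Integrable (fun ω => ((N ω).real (C ∩ D) - ν.real (C ∩ D)) *
      ((N ω).real (D \ C) - ν.real (D \ C))) P :=
    (h.memLp_two_sub mI hνI).integrable_mul (h.memLp_two_sub mD hνD')
  have i3 : Integrable (fun ω => ((N ω).real (C \ D) - ν.real (C \ D)) *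
      ((N ω).real D - ν.real D)) P :=
    (h.memLp_two_sub mC hνC').integrable_mul (h.memLp_two_sub hD hνD)
  rw [integral_congr_ae e, integral_add (by exact i1.add i2) i3, integral_add i1 i2,
    h.integral_sub_sq mI hνI, h.integral_sub_mul_sub_of_disjoint mI hνI mD
      (disjoint_sdiff_right.mono_left inter_subset_left),
    h.integral_sub_mul_sub_of_disjoint mC hνC' hD disjoint_sdiff_left]
  simp

end IsPoissonRandomMeasure

/-- A Poisson random measure `N` on (time) × (marks) relative to the filtration `F`. -/
structure IsAdaptedPoisson {Ω : Type*} [mΩ : MeasurableSpace Ω] (P : Measure Ω)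
    (F : Filtration ℝ mΩ) (ν : Measure (ℝ × ℝ)) (N : Ω → Measure (ℝ × ℝ)) : Prop where
  poisson : IsPoissonRandomMeasure P ν N
  adapted : ∀ t : ℝ, 0 ≤ t → Measurable[F t] (fun ω => (N ω).restrict (Iic t ×ˢ univ))
  indep_future : ∀ t : ℝ, 0 ≤ t →
    Indep (MeasurableSpace.comap (fun ω => (N ω).restrict (Ioi t ×ˢ univ)) inferInstance) (F t) P

theorem IsPoissonFamily.isAdaptedPoisson {Ω : Type*} [mΩ : MeasurableSpace Ω] {m : ℕ}
    {P : Measure Ω} {F : Filtration ℝ mΩ} {ν : Fin m → Measure (ℝ × ℝ)}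
    {N : Fin m → Ω → Measure (ℝ × ℝ)} (h : IsPoissonFamily P F ν N) (k : Fin m) :
    IsAdaptedPoisson P F (ν k) (N k) where
  poisson := h.poisson k
  adapted := h.adapted k
  indep_future t ht := indep_of_indep_of_le_left (h.indep_future t ht)
    (le_iSup (fun k => MeasurableSpace.comap
      (fun ω => (N k ω).restrict (Ioi t ×ˢ univ)) inferInstance) k)

/-! ### Measures of sections of random sets -/

section Sections

variable {Ω S : Type*} [MeasurableSpace Ω] [MeasurableSpace S] {B : Set S}

/-- Section measurability needs a finite kernel, while `N` is finite on `B` only almost surely; the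
kernel is set to `0` where `N ω B = ∞`. The σ-algebra on `Ω` is arbitrary, so the lemma also applies
with `F t`. -/
theorem exists_measurable_real_section {N : Ω → Measure S}
    (hN : Measurable fun ω => (N ω).restrict B) {H : Set (Ω × S)}
    (hH : MeasurableSet H) :
    ∃ f : Ω → ℝ, Measurable f ∧ ∀ ω, N ω B ≠ ∞ → f ω = (N ω).real (B ∩ Prod.mk ω ⁻¹' H) := by
  classical
  have hBm : Measurable fun ω => N ω B := by
    have := (Measure.measurable_coe (MeasurableSet.univ (α := S))).comp hN
    simpa [Function.comp_def] using this
  let κ : Kernel Ω S :=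
    ⟨fun ω => if N ω B = ∞ then 0 else (N ω).restrict B,
      Measurable.ite (hBm (measurableSet_singleton ∞)) measurable_const hN⟩
  have hκ : ∀ ω, κ ω = if N ω B = ∞ then 0 else (N ω).restrict B := fun ω => rfl
  have hfin : ∀ ω, IsFiniteMeasure (κ ω) := by
    intro ω
    rw [hκ]
    split_ifs with h
    · infer_instance
    · exact ⟨by simpa using lt_top_iff_ne_top.2 h⟩
  refine ⟨fun ω => (κ ω (Prod.mk ω ⁻¹' H)).toReal,
    (Kernel.measurable_kernel_prodMk_left_of_finite hH hfin).ennreal_toReal, fun ω hω => ?_⟩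
  simp only [hκ, hω, if_false]
  rw [Measure.restrict_apply (measurable_prodMk_left hH), inter_comm, measureReal_def]

theorem measurable_real_section_const {ν : Measure S} (hν : ν B ≠ ∞)
    {H : Set (Ω × S)} (hH : MeasurableSet H) :
    Measurable fun ω => ν.real (B ∩ Prod.mk ω ⁻¹' H) := by
  obtain ⟨f, hf, hfe⟩ := exists_measurable_real_section (N := fun _ : Ω => ν) (B := B)
    measurable_const hH
  convert hf with ω
  exact (hfe ω hν).symm

theorem hasSum_real_section {μ : Measure S} (hB : MeasurableSet B) (hμ : μ B ≠ ∞)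
    {f : ℕ → Set (Ω × S)} (hd : Pairwise (Function.onFun Disjoint f))
    (hf : ∀ i, MeasurableSet (f i)) (ω : Ω) :
    HasSum (fun i => μ.real (B ∩ Prod.mk ω ⁻¹' f i)) (μ.real (B ∩ Prod.mk ω ⁻¹' ⋃ i, f i)) := by
  have e : μ (B ∩ Prod.mk ω ⁻¹' ⋃ i, f i) = ∑' i, μ (B ∩ Prod.mk ω ⁻¹' f i) := by
    rw [preimage_iUnion, inter_iUnion, measure_iUnion]
    · intro i j hij
      exact ((hd hij).preimage _).mono inter_subset_right inter_subset_right
    · exact fun i => hB.inter (measurable_prodMk_left (hf i))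
  have hne : ∑' i, μ (B ∩ Prod.mk ω ⁻¹' f i) ≠ ∞ := by
    rw [← e]
    exact measure_ne_top_of_subset inter_subset_left hμ
  rw [measureReal_def, e, ENNReal.tsum_toReal_eq fun i => ne_top_of_le_ne_top hne
    (ENNReal.le_tsum i)]
  exact ENNReal.hasSum_toReal hne

end Sections

/-! ### Compensated measure of predictable sets and its isometry -/

section Compensated

variable {Ω : Type*} [mΩ : MeasurableSpace Ω]

/-- The generators `A × (s, ∞) × C`, with `A ∈ F s`, of the predictable σ-algebra. -/
def predictableRectangles (F : Filtration ℝ mΩ) : Set (Set (Ω × ℝ × ℝ)) :=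
  {H | ∃ (s : ℝ) (A : Set Ω) (C : Set ℝ), MeasurableSet[F s] A ∧ MeasurableSet C ∧
    H = A ×ˢ (Ioi s ×ˢ C)}

/-- The predictable σ-algebra on `Ω × (time) × (marks)`. -/
@[reducible]
def markedPredictable (F : Filtration ℝ mΩ) : MeasurableSpace (Ω × ℝ × ℝ) :=
  MeasurableSpace.generateFrom (predictableRectangles F)

theorem isPiSystem_predictableRectangles (F : Filtration ℝ mΩ) :
    IsPiSystem (predictableRectangles F) := by
  rintro _ ⟨s, A, C, hA, hC, rfl⟩ _ ⟨s', A', C', hA', hC', rfl⟩ -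
  refine ⟨max s s', A ∩ A', C ∩ C', ?_, hC.inter hC', ?_⟩
  · exact (F.mono (le_max_left s s') _ hA).inter (F.mono (le_max_right s s') _ hA')
  · rw [prod_inter_prod, prod_inter_prod, Ioi_inter_Ioi]

theorem markedPredictable_le (F : Filtration ℝ mΩ) :
    markedPredictable F ≤ (inferInstance : MeasurableSpace (Ω × ℝ × ℝ)) := by
  refine MeasurableSpace.generateFrom_le ?_
  rintro _ ⟨s, A, C, hA, hC, rfl⟩
  exact (F.le s _ hA).prod (measurableSet_Ioi.prod hC)

/-- The compensated `N`-measure of the section at `ω` of `H`, within the set `B`. -/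
noncomputable def compensated (ν : Measure (ℝ × ℝ)) (N : Ω → Measure (ℝ × ℝ)) (B : Set (ℝ × ℝ))
    (H : Set (Ω × ℝ × ℝ)) (ω : Ω) : ℝ :=
  (N ω).real (B ∩ Prod.mk ω ⁻¹' H) - ν.real (B ∩ Prod.mk ω ⁻¹' H)

set_option linter.unusedSectionVars false

namespace IsAdaptedPoisson

variable {P : Measure Ω} {F : Filtration ℝ mΩ} {ν : Measure (ℝ × ℝ)} {N : Ω → Measure (ℝ × ℝ)}
  {B : Set (ℝ × ℝ)} {H G : Set (Ω × ℝ × ℝ)}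

theorem measurable_restrict (h : IsAdaptedPoisson P F ν N) (hB : MeasurableSet B) :
    Measurable fun ω => (N ω).restrict B :=
  Measure.measurable_of_measurable_coe _ fun C hC => by
    simp_rw [Measure.restrict_apply hC]
    exact (Measure.measurable_coe (hC.inter hB)).comp h.poisson.measurable

theorem aemeasurable_compensated (h : IsAdaptedPoisson P F ν N) (hB : MeasurableSet B)
    (hν : ν B ≠ ∞) (hH : MeasurableSet H) : AEMeasurable (compensated ν N B H) P := by
  obtain ⟨f, hf, hfe⟩ := exists_measurable_real_section (h.measurable_restrict hB) hH
  refine ⟨fun ω => f ω - ν.real (B ∩ Prod.mk ω ⁻¹' H),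
    hf.sub (measurable_real_section_const hν hH), ?_⟩
  filter_upwards [h.poisson.ae_ne_top hB hν] with ω hω
  rw [compensated, hfe ω hω]

theorem abs_compensated_le (h : IsAdaptedPoisson P F ν N) (hB : MeasurableSet B)
    (hν : ν B ≠ ∞) (H : Set (Ω × ℝ × ℝ)) :
    ∀ᵐ ω ∂P, |compensated ν N B H ω| ≤ (N ω).real B + ν.real B := by
  filter_upwards [h.poisson.ae_ne_top hB hν] with ω hω
  have h1 : (N ω).real (B ∩ Prod.mk ω ⁻¹' H) ≤ (N ω).real B :=
    measureReal_mono inter_subset_left hω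
  have h2 : ν.real (B ∩ Prod.mk ω ⁻¹' H) ≤ ν.real B := measureReal_mono inter_subset_left hν
  have h3 : 0 ≤ (N ω).real (B ∩ Prod.mk ω ⁻¹' H) := measureReal_nonneg
  have h4 : 0 ≤ ν.real (B ∩ Prod.mk ω ⁻¹' H) := measureReal_nonneg
  rw [compensated, abs_le]
  constructor <;> linarith

variable [IsProbabilityMeasure P]

theorem memLp_compensated (h : IsAdaptedPoisson P F ν N) (hB : MeasurableSet B)
    (hν : ν B ≠ ∞) (hH : MeasurableSet H) : MemLp (compensated ν N B H) 2 P := by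
  refine MemLp.mono' ((h.poisson.memLp_two_real hB hν).add (memLp_const (ν.real B)))
    (h.aemeasurable_compensated hB hν hH).aestronglyMeasurable ?_
  exact h.abs_compensated_le hB hν H

/-- Replacing `s` by `max s 0` loses nothing, as `B` lies in positive times; adaptedness and
independence are available only from time `0` on. -/
theorem exists_section_eq (hB : MeasurableSet B) (hBpos : B ⊆ Ioi 0 ×ˢ univ)
    (hH : H ∈ predictableRectangles F) :
    ∃ (s : ℝ) (A : Set Ω) (Q : Set (ℝ × ℝ)), 0 ≤ s ∧ MeasurableSet[F s] A ∧ MeasurableSet Q ∧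
      Q ⊆ B ∧ Q ⊆ Ioi s ×ˢ univ ∧ (∀ ω ∈ A, B ∩ Prod.mk ω ⁻¹' H = Q) ∧
      ∀ ω ∉ A, B ∩ Prod.mk ω ⁻¹' H = ∅ := by
  obtain ⟨s, A, C, hA, hC, rfl⟩ := hH
  refine ⟨max s 0, A, B ∩ Ioi s ×ˢ C, le_max_right _ _, F.mono (le_max_left _ _) _ hA,
    hB.inter (measurableSet_Ioi.prod hC), inter_subset_left, ?_, ?_, ?_⟩
  · rintro ⟨t, z⟩ ⟨hb, ht, -⟩
    exact ⟨max_lt (mem_Ioi.1 ht) (mem_Ioi.1 (hBpos hb).1), trivial⟩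
  · intro ω hω
    rw [mk_preimage_prod_right hω]
  · intro ω hω
    rw [mk_preimage_prod_right_eq_empty hω, inter_empty]

theorem compensated_eq_indicator {A : Set Ω} {Q : Set (ℝ × ℝ)}
    (h1 : ∀ ω ∈ A, B ∩ Prod.mk ω ⁻¹' H = Q) (h2 : ∀ ω ∉ A, B ∩ Prod.mk ω ⁻¹' H = ∅) (ω : Ω) :
    compensated ν N B H ω = A.indicator 1 ω * ((N ω).real Q - ν.real Q) := by
  by_cases hω : ω ∈ A
  · simp [compensated, h1 ω hω, hω]
  · simp [compensated, h2 ω hω, hω]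

theorem integral_mul_eq_of_past_future (h : IsAdaptedPoisson P F ν N) {s : ℝ} (hs : 0 ≤ s)
    {X Y : Ω → ℝ} (hX : Measurable[F s] X)
    (hY : Measurable[MeasurableSpace.comap (fun ω => (N ω).restrict (Ioi s ×ˢ univ))
      inferInstance] Y) :
    ∫ ω, X ω * Y ω ∂P = (∫ ω, X ω ∂P) * ∫ ω, Y ω ∂P := by
  have hle : MeasurableSpace.comap (fun ω => (N ω).restrict (Ioi s ×ˢ univ)) inferInstance ≤ mΩ :=
    (h.measurable_restrict (measurableSet_Ioi.prod MeasurableSet.univ)).comap_le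
  refine IndepFun.integral_fun_mul_eq_mul_integral ?_
    (hX.mono (F.le s) le_rfl).aestronglyMeasurable (hY.mono hle le_rfl).aestronglyMeasurable
  rw [IndepFun_iff_Indep]
  exact indep_of_indep_of_le_left (indep_of_indep_of_le_right (h.indep_future s hs).symm
    hY.comap_le) hX.comap_le

theorem measurable_real_future (N : Ω → Measure (ℝ × ℝ)) {s : ℝ} {Q : Set (ℝ × ℝ)}
    (hQ : MeasurableSet Q) (hQs : Q ⊆ Ioi s ×ˢ univ) :
    Measurable[MeasurableSpace.comap (fun ω => (N ω).restrict (Ioi s ×ˢ univ)) inferInstance]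
      fun ω => (N ω).real Q := by
  have h1 : Measurable fun μ : Measure (ℝ × ℝ) => μ.real Q :=
    (Measure.measurable_coe hQ).ennreal_toReal
  have h2 := h1.comp (comap_measurable (m := inferInstance)
    (fun ω => (N ω).restrict (Ioi s ×ˢ univ)))
  convert h2 using 2 with ω
  simp only [Function.comp]
  rw [measureReal_restrict_apply hQ, inter_eq_left.2 hQs]

theorem measurable_real_past (h : IsAdaptedPoisson P F ν N) {s : ℝ} (hs : 0 ≤ s)
    {Q : Set (ℝ × ℝ)} (hQ : MeasurableSet Q) (hQs : Q ⊆ Iic s ×ˢ univ) :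
    Measurable[F s] fun ω => (N ω).real Q := by
  have h1 : Measurable fun μ : Measure (ℝ × ℝ) => μ.real Q :=
    (Measure.measurable_coe hQ).ennreal_toReal
  have h2 := h1.comp (h.adapted s hs)
  convert h2 using 2 with ω
  simp only [Function.comp]
  rw [measureReal_restrict_apply hQ, inter_eq_left.2 hQs]

theorem integral_compensated_of_rectangle (h : IsAdaptedPoisson P F ν N) (hB : MeasurableSet B)
    (hBpos : B ⊆ Ioi 0 ×ˢ univ) (hν : ν B ≠ ∞) (hH : H ∈ predictableRectangles F) :
    ∫ ω, compensated ν N B H ω ∂P = 0 := by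
  obtain ⟨s, A, Q, hs, hA, hQ, hQB, hQs, h1, h2⟩ := exists_section_eq hB hBpos hH
  have hνQ : ν Q ≠ ∞ := measure_ne_top_of_subset hQB hν
  simp_rw [compensated_eq_indicator h1 h2]
  have mA : Measurable[F s] (A.indicator (1 : Ω → ℝ)) :=
    (measurable_indicator_const_iff (m := F s) (1 : ℝ)).2 hA
  rw [h.integral_mul_eq_of_past_future hs mA
    ((measurable_real_future N hQ hQs).sub_const _), h.poisson.integral_sub_eq_zero hQ hνQ,
    mul_zero]

/-- Let `s ≤ s'` be the two starting times and cut the earlier set `Q` at `s'`. Its past part `Q1`,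
with the indicator of `A ∩ A'`, is `F s'`-measurable, hence independent of the centred future
increment on `Q'`, and contributes `0`. The future part `Q2` contributes the Poisson covariance `ν
(Q2 ∩ Q') = ν (Q ∩ Q')`. -/
theorem integral_compensated_mul_of_rectangle (h : IsAdaptedPoisson P F ν N)
    (hB : MeasurableSet B) (hBpos : B ⊆ Ioi 0 ×ˢ univ) (hν : ν B ≠ ∞)
    (hH : H ∈ predictableRectangles F) (hG : G ∈ predictableRectangles F) :
    ∫ ω, compensated ν N B G ω * compensated ν N B H ω ∂P =
      ∫ ω, ν.real (B ∩ Prod.mk ω ⁻¹' (H ∩ G)) ∂P := by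
  obtain ⟨s, A, Q, hs, hA, hQ, hQB, hQs, h1, h2⟩ := exists_section_eq hB hBpos hH
  obtain ⟨s', A', Q', hs', hA', hQ', hQB', hQs', h1', h2'⟩ := exists_section_eq hB hBpos hG
  have e : ∀ ω, ν.real (B ∩ Prod.mk ω ⁻¹' (H ∩ G)) = (A ∩ A').indicator 1 ω * ν.real (Q ∩ Q') := by
    intro ω
    have : B ∩ Prod.mk ω ⁻¹' (H ∩ G) = (B ∩ Prod.mk ω ⁻¹' H) ∩ (B ∩ Prod.mk ω ⁻¹' G) := by
      rw [preimage_inter]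
      exact inter_inter_distrib_left _ _ _
    rw [this]
    by_cases hω : ω ∈ A
    · by_cases hω' : ω ∈ A'
      · simp [h1 ω hω, h1' ω hω', hω, hω']
      · simp [h2' ω hω', hω']
    · simp [h2 ω hω, hω]
  simp_rw [e, compensated_eq_indicator h1 h2, compensated_eq_indicator h1' h2']
  clear e h1 h2 h1' h2' hH hG
  wlog hss : s ≤ s' generalizing s s' A A' Q Q'
  · have := this s' A' Q' hs' hA' hQ' hQB' hQs' s A Q hs hA hQ hQB hQs (le_of_not_ge hss)
    rw [inter_comm A, inter_comm Q, ← this]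
    exact integral_congr_ae (ae_of_all _ fun ω => mul_comm _ _)
  have hνQ : ν Q ≠ ∞ := measure_ne_top_of_subset hQB hν
  have hνQ' : ν Q' ≠ ∞ := measure_ne_top_of_subset hQB' hν
  set Q1 := Q ∩ Iic s' ×ˢ univ with hQ1d
  set Q2 := Q ∩ Ioi s' ×ˢ univ with hQ2d
  have hQ1 : MeasurableSet Q1 := hQ.inter (measurableSet_Iic.prod MeasurableSet.univ)
  have hQ2 : MeasurableSet Q2 := hQ.inter (measurableSet_Ioi.prod MeasurableSet.univ)
  have hνQ1 : ν Q1 ≠ ∞ := measure_ne_top_of_subset inter_subset_left hνQ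
  have hνQ2 : ν Q2 ≠ ∞ := measure_ne_top_of_subset inter_subset_left hνQ
  have hQ12 : Q \ (Iic s' ×ˢ univ) = Q2 := by
    ext ⟨t, z⟩
    simp [hQ2d]
  have hQ2' : Q2 ∩ Q' = Q ∩ Q' := by
    rw [hQ2d, inter_assoc, inter_eq_right.2 hQs']
  have hAA : MeasurableSet[F s'] (A ∩ A') := (F.mono hss _ hA).inter hA'
  have mAA : Measurable[F s'] ((A ∩ A').indicator (1 : Ω → ℝ)) :=
    (measurable_indicator_const_iff (m := F s') (1 : ℝ)).2 hAA
  have mN1 : Measurable[F s'] fun ω => (N ω).real Q1 - ν.real Q1 :=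
    (h.measurable_real_past hs' hQ1 inter_subset_right).sub_const _
  have mN2 := (measurable_real_future N hQ2 (s := s') inter_subset_right).sub_const (ν.real Q2)
  have mN' := (measurable_real_future N hQ' hQs').sub_const (ν.real Q')
  have e : (fun ω => A'.indicator 1 ω * ((N ω).real Q' - ν.real Q') *
      (A.indicator 1 ω * ((N ω).real Q - ν.real Q))) =ᵐ[P] fun ω =>
      ((A ∩ A').indicator 1 ω * ((N ω).real Q1 - ν.real Q1)) * ((N ω).real Q' - ν.real Q') +
      (A ∩ A').indicator 1 ω *
        (((N ω).real Q2 - ν.real Q2) * ((N ω).real Q' - ν.real Q')) := by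
    filter_upwards [h.poisson.ae_ne_top hQ hνQ] with ω hω
    have i1 := measureReal_inter_add_sdiff (μ := N ω)
      ((measurableSet_Iic (a := s')).prod (MeasurableSet.univ (α := ℝ))) hω
    have i2 := measureReal_inter_add_sdiff (μ := ν)
      ((measurableSet_Iic (a := s')).prod (MeasurableSet.univ (α := ℝ))) hνQ
    rw [hQ12] at i1 i2
    rw [← i1, ← i2, inter_indicator_one]
    simp only [Pi.mul_apply]
    ring
  have b1 : MemLp (fun ω => (A ∩ A').indicator (1 : Ω → ℝ) ω * ((N ω).real Q1 - ν.real Q1)) 2 P := by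
    have := (h.poisson.memLp_two_sub hQ1 hνQ1).indicator (F.le s' _ hAA)
    refine this.ae_eq (ae_of_all _ fun ω => ?_)
    by_cases hω : ω ∈ A ∩ A' <;> simp only [indicator_of_mem, indicator_of_notMem, hω,
      not_false_eq_true, Pi.one_apply, one_mul, zero_mul]
  have j1 : Integrable (fun ω => ((A ∩ A').indicator 1 ω * ((N ω).real Q1 - ν.real Q1)) *
      ((N ω).real Q' - ν.real Q')) P :=
    b1.integrable_mul (h.poisson.memLp_two_sub hQ' hνQ')
  have b2 : Integrable (fun ω => ((N ω).real Q2 - ν.real Q2) * ((N ω).real Q' - ν.real Q')) P :=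
    (h.poisson.memLp_two_sub hQ2 hνQ2).integrable_mul (h.poisson.memLp_two_sub hQ' hνQ')
  have j2 : Integrable (fun ω => (A ∩ A').indicator 1 ω *
      (((N ω).real Q2 - ν.real Q2) * ((N ω).real Q' - ν.real Q'))) P := by
    refine (b2.indicator (F.le s' _ hAA)).congr (ae_of_all _ fun ω => ?_)
    by_cases hω : ω ∈ A ∩ A' <;> simp only [indicator_of_mem, indicator_of_notMem, hω,
      not_false_eq_true, Pi.one_apply, one_mul, zero_mul]
  have k1 := h.integral_mul_eq_of_past_future hs' (mAA.mul mN1) mN'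
  have k2 := h.integral_mul_eq_of_past_future hs' mAA (mN2.mul mN')
  simp only [Pi.mul_apply] at k1 k2
  rw [integral_congr_ae e, integral_add j1 j2, k1, k2,
    h.poisson.integral_sub_eq_zero hQ' hνQ', mul_zero, zero_add,
    h.poisson.integral_sub_mul_sub hQ2 hνQ2 hQ' hνQ', hQ2', integral_mul_const]

/-- An identity `E [Z W(H)] = E [ν (H ∩ G)]`, `W` being the compensated measure, extends from the
predictable rectangles `H` to all predictable sets. -/
theorem integral_mul_compensated_of_forall_rectangle (h : IsAdaptedPoisson P F ν N)
    (hB : MeasurableSet B) (hBpos : B ⊆ Ioi 0 ×ˢ univ) (hν : ν B ≠ ∞) {Z : Ω → ℝ}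
    (hZ : MemLp Z 2 P) (hG : MeasurableSet G)
    (hrect : ∀ H ∈ predictableRectangles F, ∫ ω, Z ω * compensated ν N B H ω ∂P =
      ∫ ω, ν.real (B ∩ Prod.mk ω ⁻¹' (H ∩ G)) ∂P)
    (hH : MeasurableSet[markedPredictable F] H) :
    ∫ ω, Z ω * compensated ν N B H ω ∂P = ∫ ω, ν.real (B ∩ Prod.mk ω ⁻¹' (H ∩ G)) ∂P := by
  have hprod : ∀ H, MeasurableSet[markedPredictable F] H → MeasurableSet H :=
    fun H hH => markedPredictable_le F _ hH
  have i1 : ∀ H, MeasurableSet H → Integrable (fun ω => Z ω * compensated ν N B H ω) P :=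
    fun H hH => hZ.integrable_mul (h.memLp_compensated hB hν hH)
  have i2 : ∀ H, MeasurableSet H → Integrable (fun ω => ν.real (B ∩ Prod.mk ω ⁻¹' H)) P := by
    intro H hH
    refine Integrable.mono' (integrable_const (ν.real B))
      (measurable_real_section_const hν hH).aestronglyMeasurable (ae_of_all _ fun ω => ?_)
    rw [Real.norm_of_nonneg measureReal_nonneg]
    exact measureReal_mono inter_subset_left hν
  -- The whole space is not a rectangle, but within `B` it has the same sections as the rectangle of
  -- all positive times.
  have huniv : ∫ ω, Z ω * compensated ν N B univ ω ∂P =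
      ∫ ω, ν.real (B ∩ Prod.mk ω ⁻¹' (univ ∩ G)) ∂P := by
    have hmem : (univ ×ˢ (Ioi 0 ×ˢ univ) : Set (Ω × ℝ × ℝ)) ∈ predictableRectangles F :=
      ⟨0, univ, univ, MeasurableSet.univ, MeasurableSet.univ, rfl⟩
    have e : ∀ ω : Ω, B ∩ Prod.mk ω ⁻¹' (univ ×ˢ (Ioi 0 ×ˢ univ)) = B ∩ Prod.mk ω ⁻¹' univ := by
      intro ω
      rw [mk_preimage_prod_right (mem_univ ω), preimage_univ, inter_univ, inter_eq_left.2 hBpos]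
    have := hrect _ hmem
    simp only [compensated, preimage_inter, ← inter_assoc, e] at this ⊢
    exact this
  -- Dynkin's π-λ argument: both sides are additive in `H` and continuous along disjoint unions.
  induction H, hH using MeasurableSpace.induction_on_inter (m := markedPredictable F)
    (s := predictableRectangles F) rfl (isPiSystem_predictableRectangles F) with
  | empty => simp [compensated]
  | basic t ht => exact hrect t ht
  | compl t htm ih =>
    have ht := hprod t htm
    have hsec : ∀ ω : Ω, MeasurableSet (Prod.mk ω ⁻¹' t) := fun ω => measurable_prodMk_left ht
    have hsecG : ∀ ω : Ω, MeasurableSet (Prod.mk ω ⁻¹' G) := fun ω => measurable_prodMk_left hG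
    have e1 : (fun ω => Z ω * compensated ν N B tᶜ ω) =ᵐ[P] fun ω =>
        Z ω * compensated ν N B univ ω - Z ω * compensated ν N B t ω := by
      filter_upwards [h.poisson.ae_ne_top hB hν] with ω hω
      have i1 := measureReal_inter_add_sdiff (μ := N ω) (hsec ω) hω
      have i2 := measureReal_inter_add_sdiff (μ := ν) (hsec ω) hν
      simp only [compensated, preimage_compl, preimage_univ, inter_univ, ← sdiff_eq]
      rw [← i1, ← i2]
      ring
    have e2 : ∀ ω, ν.real (B ∩ Prod.mk ω ⁻¹' (tᶜ ∩ G)) =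
        ν.real (B ∩ Prod.mk ω ⁻¹' (univ ∩ G)) - ν.real (B ∩ Prod.mk ω ⁻¹' (t ∩ G)) := by
      intro ω
      have hne : ν (B ∩ Prod.mk ω ⁻¹' G) ≠ ∞ := measure_ne_top_of_subset inter_subset_left hν
      have i2 := measureReal_inter_add_sdiff (μ := ν) (hsec ω) hne
      rw [univ_inter, ← i2]
      have s1 : B ∩ Prod.mk ω ⁻¹' G ∩ Prod.mk ω ⁻¹' t = B ∩ Prod.mk ω ⁻¹' (t ∩ G) := by
        rw [preimage_inter, inter_assoc, inter_comm (Prod.mk ω ⁻¹' G)]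
      have s2 : (B ∩ Prod.mk ω ⁻¹' G) \ Prod.mk ω ⁻¹' t = B ∩ Prod.mk ω ⁻¹' (tᶜ ∩ G) := by
        rw [preimage_inter, preimage_compl, sdiff_eq, inter_assoc,
          inter_comm (Prod.mk ω ⁻¹' G)]
      rw [s1, s2]
      ring
    rw [integral_congr_ae e1, integral_sub (i1 _ MeasurableSet.univ) (i1 _ ht), huniv, ih]
    simp_rw [e2]
    rw [integral_sub (i2 _ (MeasurableSet.univ.inter hG)) (i2 _ (ht.inter hG))]
  | iUnion f hd hfm ih =>
    have hf : ∀ i, MeasurableSet (f i) := fun i => hprod _ (hfm i)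
    have hdG : Pairwise (Function.onFun Disjoint fun i => f i ∩ G) := fun i j hij =>
      (hd hij).mono inter_subset_left inter_subset_left
    have c1 : HasSum (fun i => ∫ ω, Z ω * compensated ν N B (f i) ω ∂P)
        (∫ ω, Z ω * compensated ν N B (⋃ i, f i) ω ∂P) := by
      have hs : ∀ᵐ ω ∂P, HasSum (fun i => |Z ω| * ((N ω).real (B ∩ Prod.mk ω ⁻¹' f i) +
          ν.real (B ∩ Prod.mk ω ⁻¹' f i))) (|Z ω| * ((N ω).real (B ∩ Prod.mk ω ⁻¹' ⋃ i, f i) +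
          ν.real (B ∩ Prod.mk ω ⁻¹' ⋃ i, f i))) := by
        filter_upwards [h.poisson.ae_ne_top hB hν] with ω hω
        exact ((hasSum_real_section hB hω hd hf ω).add
          (hasSum_real_section hB hν hd hf ω)).mul_left _
      refine hasSum_integral_of_dominated_convergence
        (fun i ω => |Z ω| * ((N ω).real (B ∩ Prod.mk ω ⁻¹' f i) +
          ν.real (B ∩ Prod.mk ω ⁻¹' f i))) (fun i => (i1 _ (hf i)).aestronglyMeasurable)
        (fun i => ae_of_all _ fun ω => ?_) (hs.mono fun ω hω => hω.summable) ?_ ?_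
      · rw [Real.norm_eq_abs, abs_mul]
        refine mul_le_mul_of_nonneg_left ?_ (abs_nonneg _)
        refine (abs_sub _ _).trans ?_
        rw [abs_of_nonneg measureReal_nonneg, abs_of_nonneg measureReal_nonneg]
      -- Since `N + ν = W + 2ν`, the dominating sum is `|Z|` times a square integrable variable,
      -- hence integrable.
      · have e : (fun ω => ∑' i, |Z ω| * ((N ω).real (B ∩ Prod.mk ω ⁻¹' f i) +
            ν.real (B ∩ Prod.mk ω ⁻¹' f i))) =ᵐ[P] fun ω => |Z ω| *
            (compensated ν N B (⋃ i, f i) ω + 2 * ν.real (B ∩ Prod.mk ω ⁻¹' ⋃ i, f i)) := by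
          filter_upwards [hs] with ω hω
          rw [hω.tsum_eq, compensated]
          ring
        refine Integrable.congr ?_ e.symm
        refine MemLp.integrable_mul (p := 2) (q := 2) hZ.abs ?_
        refine (h.memLp_compensated hB hν (MeasurableSet.iUnion hf)).add ?_
        refine MemLp.const_mul (MemLp.of_bound (measurable_real_section_const hν
          (MeasurableSet.iUnion hf)).aestronglyMeasurable (ν.real B) (ae_of_all _ fun ω => ?_)) 2
        rw [Real.norm_of_nonneg measureReal_nonneg]
        exact measureReal_mono inter_subset_left hν
      · filter_upwards [h.poisson.ae_ne_top hB hν] with ω hω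
        exact ((hasSum_real_section hB hω hd hf ω).sub
          (hasSum_real_section hB hν hd hf ω)).mul_left _
    have c2 : HasSum (fun i => ∫ ω, ν.real (B ∩ Prod.mk ω ⁻¹' (f i ∩ G)) ∂P)
        (∫ ω, ν.real (B ∩ Prod.mk ω ⁻¹' ((⋃ i, f i) ∩ G)) ∂P) := by
      have hs : ∀ ω, HasSum (fun i => ν.real (B ∩ Prod.mk ω ⁻¹' (f i ∩ G)))
          (ν.real (B ∩ Prod.mk ω ⁻¹' ((⋃ i, f i) ∩ G))) := by
        intro ω
        rw [iUnion_inter]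
        exact hasSum_real_section hB hν hdG (fun i => (hf i).inter hG) ω
      refine hasSum_integral_of_dominated_convergence
        (fun i ω => ν.real (B ∩ Prod.mk ω ⁻¹' (f i ∩ G)))
        (fun i => (i2 _ ((hf i).inter hG)).aestronglyMeasurable)
        (fun i => ae_of_all _ fun ω => (Real.norm_of_nonneg measureReal_nonneg).le)
        (ae_of_all _ fun ω => (hs ω).summable) ?_ (ae_of_all _ hs)
      simp_rw [fun ω => (hs ω).tsum_eq]
      exact i2 _ ((MeasurableSet.iUnion hf).inter hG)
    simp_rw [ih] at c1
    exact c1.unique c2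

/-- The extension principle with `Z = 1` and `G = ∅`, whose right-hand side vanishes. -/
theorem integral_compensated (h : IsAdaptedPoisson P F ν N) (hB : MeasurableSet B)
    (hBpos : B ⊆ Ioi 0 ×ˢ univ) (hν : ν B ≠ ∞) (hH : MeasurableSet[markedPredictable F] H) :
    ∫ ω, compensated ν N B H ω ∂P = 0 := by
  have := h.integral_mul_compensated_of_forall_rectangle hB hBpos hν (Z := fun _ => 1)
    (memLp_const _) (G := ∅) MeasurableSet.empty
    (by
      intro H hH
      simpa using h.integral_compensated_of_rectangle hB hBpos hν hH) hH
  simpa using this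

/-- The bilinear identity known on rectangles is extended one variable at a time: first with `Z =
W(G)` for a rectangle `G`, then with `Z = W(H)`. -/
theorem integral_compensated_sq (h : IsAdaptedPoisson P F ν N) (hB : MeasurableSet B)
    (hBpos : B ⊆ Ioi 0 ×ˢ univ) (hν : ν B ≠ ∞) (hH : MeasurableSet[markedPredictable F] H) :
    ∫ ω, compensated ν N B H ω ^ 2 ∂P = ∫ ω, ν.real (B ∩ Prod.mk ω ⁻¹' H) ∂P := by
  have hH' := markedPredictable_le F _ hH
  have key : ∀ G ∈ predictableRectangles F,
      ∫ ω, compensated ν N B H ω * compensated ν N B G ω ∂P =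
        ∫ ω, ν.real (B ∩ Prod.mk ω ⁻¹' (G ∩ H)) ∂P := by
    intro G hG
    have hG' := markedPredictable_le F _ (MeasurableSpace.measurableSet_generateFrom hG)
    rw [inter_comm G H, ← h.integral_mul_compensated_of_forall_rectangle hB hBpos hν
      (h.memLp_compensated hB hν hG') hG'
      (fun H hH => h.integral_compensated_mul_of_rectangle hB hBpos hν hH hG) hH]
    exact integral_congr_ae (ae_of_all _ fun ω => mul_comm _ _)
  have := h.integral_mul_compensated_of_forall_rectangle hB hBpos hν
    (h.memLp_compensated hB hν hH') hH' key hH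
  simpa [sq] using this

end IsAdaptedPoisson

end Compensated

/-! ### Doob's maximal inequality in discrete time -/

section Maximal

set_option linter.unusedSectionVars false

theorem aemeasurable_finset_sup {Ω : Type*} [MeasurableSpace Ω] {P : Measure Ω} {f : ℕ → Ω → ℝ≥0∞}
    (hf : ∀ i, AEMeasurable (f i) P) (s : Finset ℕ) :
    AEMeasurable (fun ω => s.sup fun i => f i ω) P := by
  simp_rw [Finset.sup_eq_iSup]
  exact .iSup fun i => .iSup fun _ => hf i

variable {Ω : Type*} [mΩ : MeasurableSpace Ω] {P : Measure Ω} [IsProbabilityMeasure P]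

theorem Martingale.submartingale_abs {𝒢 : Filtration ℕ mΩ} {f : ℕ → Ω → ℝ}
    (hf : Martingale f 𝒢 P) : Submartingale (fun i ω => |f i ω|) 𝒢 P :=
  hf.submartingale.sup hf.neg.submartingale

/-- Doob's inequality gives `ε P(A) ≤ E [|f n|; A]`. Young's inequality `|x| ≤ ε/2 + x²/(2ε)` then
lets half of the left side absorb the first term. -/
theorem Martingale.measure_le_max_abs_le {𝒢 : Filtration ℕ mΩ} {f : ℕ → Ω → ℝ}
    (hf : Martingale f 𝒢 P) (n : ℕ) (h2 : MemLp (f n) 2 P) {σ : ℝ}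
    (hfσ : ∫ ω, f n ω ^ 2 ∂P ≤ σ ^ 2) {ε : ℝ} (hε : 0 < ε) :
    P {ω | ε ≤ (Finset.range (n + 1)).sup' Finset.nonempty_range_add_one fun k => |f k ω|} ≤
      ENNReal.ofReal (σ ^ 2 * ε ^ (-2 : ℝ)) := by
  have hsub := Martingale.submartingale_abs hf
  have h := maximal_ineq hsub (fun i ω => abs_nonneg (f i ω)) (ε := ⟨ε, hε.le⟩) n
  change ENNReal.ofNNReal ⟨ε, hε.le⟩ *
    P {ω | ε ≤ (Finset.range (n + 1)).sup' Finset.nonempty_range_add_one fun k => |f k ω|} ≤ _ at h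
  set A := {ω | ε ≤ (Finset.range (n + 1)).sup' Finset.nonempty_range_add_one fun k => |f k ω|}
  have hbound : ∫ ω in A, |f n ω| ∂P ≤ ε / 2 * P.real A + σ ^ 2 / (2 * ε) := by
    have hi : Integrable (fun ω => f n ω ^ 2 / (2 * ε)) P := h2.integrable_sq.div_const _
    calc ∫ ω in A, |f n ω| ∂P ≤ ∫ ω in A, (ε / 2 + f n ω ^ 2 / (2 * ε)) ∂P := by
          refine integral_mono (hsub.integrable n).integrableOn
            ((integrable_const _).add hi.integrableOn) fun ω => ?_
          have : ε / 2 + f n ω ^ 2 / (2 * ε) - |f n ω| = (ε - |f n ω|) ^ 2 / (2 * ε) := by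
            rw [← sq_abs (f n ω)]
            field_simp
            ring
          have h0 : 0 ≤ (ε - |f n ω|) ^ 2 / (2 * ε) := by positivity
          linarith
      _ = ε / 2 * P.real A + ∫ ω in A, f n ω ^ 2 / (2 * ε) ∂P := by
          rw [integral_add (integrable_const _) hi.integrableOn]
          simp [mul_comm]
      _ ≤ ε / 2 * P.real A + ∫ ω, f n ω ^ 2 / (2 * ε) ∂P := by
          exact add_le_add_right (setIntegral_le_integral hi (ae_of_all _ fun ω => by positivity)) _
      _ ≤ _ := by
          rw [integral_div]
          gcongr
  have hreal : ε * P.real A ≤ ∫ ω in A, |f n ω| ∂P := by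
    have := ENNReal.toReal_mono ENNReal.ofReal_ne_top h
    rw [ENNReal.toReal_mul, ENNReal.toReal_ofReal (integral_nonneg fun ω => abs_nonneg _)] at this
    exact this
  rw [← ofReal_measureReal]
  refine ENNReal.ofReal_le_ofReal ?_
  have h3 : ε / 2 * P.real A ≤ σ ^ 2 / (2 * ε) := by linarith
  rw [Real.rpow_neg hε.le, Real.rpow_two, ← div_eq_mul_inv, le_div_iff₀ (by positivity)]
  rw [le_div_iff₀ (by positivity)] at h3
  linarith

/-- The first moment of the maximum of a square integrable martingale. -/
theorem Martingale.lintegral_max_abs_le {𝒢 : Filtration ℕ mΩ} {f : ℕ → Ω → ℝ}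
    (hf : Martingale f 𝒢 P) (n : ℕ) (h2 : MemLp (f n) 2 P) {σ : ℝ} (hσ : 0 < σ)
    (hfσ : ∫ ω, f n ω ^ 2 ∂P ≤ σ ^ 2) :
    ∫⁻ ω, ENNReal.ofReal ((Finset.range (n + 1)).sup' Finset.nonempty_range_add_one
      fun k => |f k ω|) ∂P ≤ ENNReal.ofReal (2 * σ) := by
  have hsub := Martingale.submartingale_abs hf
  -- Layer cake: the tail is at most `1` up to `σ` and at most `σ²/t²` beyond, and each range
  -- contributes `σ`.
  rw [lintegral_eq_lintegral_meas_le]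
  · rw [← Ioc_union_Ioi_eq_Ioi hσ.le, lintegral_union measurableSet_Ioi
      (Ioc_disjoint_Ioi le_rfl), two_mul, ENNReal.ofReal_add hσ.le hσ.le]
    gcongr
    · calc _ ≤ ∫⁻ _ in Ioc 0 σ, (1 : ℝ≥0∞) := lintegral_mono fun t => prob_le_one
        _ = _ := by simp
    · calc _ ≤ ∫⁻ t in Ioi σ, ENNReal.ofReal (σ ^ 2 * t ^ (-2 : ℝ)) := by
            refine setLIntegral_mono' measurableSet_Ioi fun t ht => ?_
            exact Martingale.measure_le_max_abs_le hf n h2 hfσ (hσ.trans ht)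
        _ = ENNReal.ofReal (∫ t in Ioi σ, σ ^ 2 * t ^ (-2 : ℝ)) := by
            rw [ofReal_integral_eq_lintegral_ofReal]
            · exact (integrableOn_Ioi_rpow_of_lt (by norm_num) hσ).const_mul _
            · filter_upwards [ae_restrict_mem measurableSet_Ioi] with t ht
              have : 0 < t := hσ.trans ht
              positivity
        _ = _ := by
            rw [integral_const_mul, integral_Ioi_rpow_of_lt (by norm_num) hσ]
            congr 1
            norm_num
            rw [Real.rpow_neg_one]
            field_simp
  · refine ae_of_all _ fun ω => ?_
    exact (abs_nonneg _).trans (Finset.le_sup' (fun k => |f k ω|)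
      (Finset.mem_range.2 (Nat.succ_pos n)))
  · exact (Finset.measurable_range_sup'' fun k _ =>
      (hsub.stronglyMeasurable k).measurable.le (𝒢.le k)).aemeasurable

end Maximal

/-! ### The compensated process in time and its maximum -/

section UpTo

set_option linter.unusedSectionVars false

variable {Ω : Type*} [mΩ : MeasurableSpace Ω]

/-- The part of `H` in times `≤ t`. -/
def upTo (H : Set (Ω × ℝ × ℝ)) (t : ℝ) : Set (Ω × ℝ × ℝ) := H ∩ {p | p.2.1 ≤ t}

variable {P : Measure Ω} {F : Filtration ℝ mΩ} {ν : Measure (ℝ × ℝ)} {N : Ω → Measure (ℝ × ℝ)}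
  {B : Set (ℝ × ℝ)} {H U : Set (Ω × ℝ × ℝ)}

theorem measurableSet_upTo (hH : MeasurableSet[markedPredictable F] H) (t : ℝ) :
    MeasurableSet[markedPredictable F] (upTo H t) := by
  have h : MeasurableSet[markedPredictable F] (univ ×ˢ (Ioi t ×ˢ univ) : Set (Ω × ℝ × ℝ)) :=
    MeasurableSpace.measurableSet_generateFrom
      ⟨t, univ, univ, MeasurableSet.univ, MeasurableSet.univ, rfl⟩
  convert hH.inter h.compl using 1
  ext ⟨ω, s, z⟩
  simp [upTo]

/-- Predictable sets are progressive: a rectangle that starts after `t` disappears, and one that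
starts earlier has its base in `F t`. -/
theorem measurableSet_prod_upTo (hH : MeasurableSet[markedPredictable F] H) (t : ℝ) :
    MeasurableSet[(F t).prod inferInstance] (upTo H t) := by
  have hE : MeasurableSet[(F t).prod inferInstance] {p : Ω × ℝ × ℝ | p.2.1 ≤ t} := by
    have : {p : Ω × ℝ × ℝ | p.2.1 ≤ t} = univ ×ˢ (Iic t ×ˢ univ) := by
      ext ⟨ω, s, z⟩
      simp
    rw [this]
    exact @MeasurableSet.prod _ _ (F t) _ _ _ MeasurableSet.univ
      (measurableSet_Iic.prod MeasurableSet.univ)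
  induction H, hH using MeasurableSpace.generateFrom_induction with
  | hC H hH _ =>
    obtain ⟨s, A, C, hA, hC, rfl⟩ := hH
    by_cases hst : s ≤ t
    · exact @MeasurableSet.inter _ ((F t).prod inferInstance) _ _
        (@MeasurableSet.prod _ _ (F t) _ _ _ (F.mono hst _ hA) (measurableSet_Ioi.prod hC)) hE
    · have : upTo (A ×ˢ (Ioi s ×ˢ C)) t = ∅ := by
        ext ⟨ω, u, z⟩
        simp only [upTo, mem_inter_iff, mem_prod, mem_Ioi, mem_ofPred_eq, mem_empty_iff_false,
          iff_false]
        rintro ⟨⟨-, h1, -⟩, h2⟩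
        exact hst (h1.le.trans h2)
      rw [this]
      exact @MeasurableSet.empty _ ((F t).prod inferInstance)
  | empty =>
    rw [upTo, empty_inter]
    exact @MeasurableSet.empty _ ((F t).prod inferInstance)
  | compl H _ ih =>
    have : upTo Hᶜ t = {p | p.2.1 ≤ t} \ upTo H t := by
      ext p
      simp only [upTo, mem_inter_iff, mem_compl_iff, Set.mem_sdiff, mem_ofPred_eq]
      tauto
    rw [this]
    exact hE.diff ih
  | iUnion f _ ih =>
    rw [upTo, iUnion_inter]
    exact MeasurableSet.iUnion ih

namespace IsAdaptedPoisson

/-- The filtration is not assumed complete, so adaptedness is obtained for a version that differs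
only where `N ω B = ∞`. -/
theorem exists_stronglyMeasurable_compensated (h : IsAdaptedPoisson P F ν N)
    (hB : MeasurableSet B) (hν : ν B ≠ ∞) (hH : MeasurableSet[markedPredictable F] H) {t : ℝ}
    (ht : 0 ≤ t) :
    ∃ f : Ω → ℝ, StronglyMeasurable[F t] f ∧ f =ᵐ[P] compensated ν N B (upTo H t) := by
  set B' := B ∩ Iic t ×ˢ univ with hB'
  have hB'm : MeasurableSet B' := hB.inter (measurableSet_Iic.prod MeasurableSet.univ)
  have hm : Measurable[F t] fun ω => (N ω).restrict B' := by
    refine @Measure.measurable_of_measurable_coe _ _ _ (F t) _ fun C hC => ?_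
    have := (Measure.measurable_coe (hC.inter hB'm)).comp (h.adapted t ht)
    convert this using 2 with ω
    rw [Function.comp, Measure.restrict_apply hC, Measure.restrict_apply (hC.inter hB'm),
      inter_assoc, inter_eq_left.2 (inter_subset_right : B' ⊆ Iic t ×ˢ univ)]
  have hHt := measurableSet_prod_upTo hH t
  obtain ⟨f, hf, hfe⟩ := @exists_measurable_real_section _ _ (F t) _ _ _ hm _ hHt
  have hν' := @measurable_real_section_const _ _ (F t) _ B ν hν _ hHt
  refine ⟨fun ω => f ω - ν.real (B ∩ Prod.mk ω ⁻¹' upTo H t), (hf.sub hν').stronglyMeasurable, ?_⟩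
  filter_upwards [h.poisson.ae_ne_top hB hν] with ω hω
  have hs : B' ∩ Prod.mk ω ⁻¹' upTo H t = B ∩ Prod.mk ω ⁻¹' upTo H t := by
    ext ⟨s, z⟩
    simp only [hB', upTo, mem_inter_iff, mem_prod, mem_Iic, mem_univ, and_true, mem_preimage,
      mem_ofPred_eq]
    tauto
  rw [compensated, hfe ω (measure_ne_top_of_subset inter_subset_left hω), hs]

/-- This turns the martingale property into `E [W] = 0`: for `A ∈ F s`, an increment restricted to
`A` is itself the compensated measure of a predictable set. -/
theorem indicator_compensated_sub (h : IsAdaptedPoisson P F ν N) (hB : MeasurableSet B)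
    (hν : ν B ≠ ∞) (H : Set (Ω × ℝ × ℝ)) {s t : ℝ} (hst : s ≤ t) (A : Set Ω) :
    ∀ᵐ ω ∂P, compensated ν N B (upTo (H ∩ A ×ˢ (Ioi s ×ˢ univ)) t) ω =
      A.indicator (fun ω => compensated ν N B (upTo H t) ω - compensated ν N B (upTo H s) ω) ω := by
  filter_upwards [h.poisson.ae_ne_top hB hν] with ω hω
  by_cases hωA : ω ∈ A
  · have key : ∀ μ : Measure (ℝ × ℝ), μ B ≠ ∞ →
        μ.real (B ∩ Prod.mk ω ⁻¹' upTo (H ∩ A ×ˢ (Ioi s ×ˢ univ)) t) =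
        μ.real (B ∩ Prod.mk ω ⁻¹' upTo H t) - μ.real (B ∩ Prod.mk ω ⁻¹' upTo H s) := by
      intro μ hμ
      rw [← measureReal_inter_add_sdiff (s := B ∩ Prod.mk ω ⁻¹' upTo H t)
        ((measurableSet_Iic (a := s)).prod (MeasurableSet.univ (α := ℝ)))
        (measure_ne_top_of_subset inter_subset_left hμ)]
      have s1 : B ∩ Prod.mk ω ⁻¹' upTo H t ∩ Iic s ×ˢ univ = B ∩ Prod.mk ω ⁻¹' upTo H s := by
        ext ⟨u, z⟩
        simp only [upTo, mem_inter_iff, mem_prod, mem_Iic, mem_univ, and_true, mem_preimage,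
          mem_ofPred_eq]
        constructor
        · tauto
        · rintro ⟨h1, h2, h3⟩
          exact ⟨⟨h1, h2, h3.trans hst⟩, h3⟩
      have s2 : (B ∩ Prod.mk ω ⁻¹' upTo H t) \ Iic s ×ˢ univ =
          B ∩ Prod.mk ω ⁻¹' upTo (H ∩ A ×ˢ (Ioi s ×ˢ univ)) t := by
        ext ⟨u, z⟩
        simp only [upTo, mem_inter_iff, mem_prod, mem_Iic, mem_univ, and_true, mem_preimage,
          mem_ofPred_eq, Set.mem_sdiff, mem_Ioi, hωA, true_and, not_le]
        tauto
      rw [s1, s2]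
      ring
    rw [indicator_of_mem hωA, compensated, key _ hω, key _ hν, compensated, compensated]
    ring
  · have : B ∩ Prod.mk ω ⁻¹' upTo (H ∩ A ×ˢ (Ioi s ×ˢ univ)) t = ∅ := by
      ext ⟨u, z⟩
      simp [upTo, hωA]
    rw [indicator_of_notMem hωA, compensated, this]
    simp

variable [IsProbabilityMeasure P]

theorem lintegral_max_compensated_le (h : IsAdaptedPoisson P F ν N) (hB : MeasurableSet B)
    (hBpos : B ⊆ Ioi 0 ×ˢ univ) (hν : ν B ≠ ∞) (hH : MeasurableSet[markedPredictable F] H)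
    {σ : ℝ} (hσ : 0 < σ) (hHσ : ∫ ω, ν.real (B ∩ Prod.mk ω ⁻¹' H) ∂P ≤ σ ^ 2)
    {t : ℕ → ℝ} (ht : Monotone t) (ht0 : ∀ i, 0 ≤ t i) (n : ℕ) :
    ∫⁻ ω, (Finset.range (n + 1)).sup (fun i => ‖compensated ν N B (upTo H (t i)) ω‖ₑ) ∂P ≤
      ENNReal.ofReal (2 * σ) := by
  have hH' := markedPredictable_le F _ hH
  have hut : ∀ i, MeasurableSet (upTo H (t i)) := fun i =>
    markedPredictable_le F _ (measurableSet_upTo hH (t i))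
  choose f hf hfe using fun i => h.exists_stronglyMeasurable_compensated hB hν hH (ht0 i)
  have hfL : ∀ i, MemLp (f i) 2 P := fun i =>
    (memLp_congr_ae (hfe i)).2 (h.memLp_compensated hB hν (hut i))
  let 𝒢 : Filtration ℕ mΩ := ⟨fun i => F (t i), fun i j hij => F.mono (ht hij), fun i => F.le _⟩
  have hmart : Martingale f 𝒢 P := by
    refine martingale_of_setIntegral_eq_succ (fun i => hf i)
      (fun i => (hfL i).integrable (by norm_num)) fun i A hA => ?_
    have hA' : MeasurableSet A := 𝒢.le i _ hA
    have hrect : MeasurableSet[markedPredictable F] (A ×ˢ (Ioi (t i) ×ˢ univ)) :=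
      MeasurableSpace.measurableSet_generateFrom ⟨t i, A, univ, hA, MeasurableSet.univ, rfl⟩
    have h0 := h.integral_compensated hB hBpos hν (measurableSet_upTo (hH.inter hrect) (t (i + 1)))
    rw [integral_congr_ae (h.indicator_compensated_sub hB hν H (ht (Nat.le_succ i)) A),
      integral_indicator hA', integral_sub
        ((h.memLp_compensated hB hν (hut _)).integrable (by norm_num)).integrableOn
        ((h.memLp_compensated hB hν (hut _)).integrable (by norm_num)).integrableOn,
      sub_eq_zero] at h0
    rw [integral_congr_ae (ae_restrict_of_ae (hfe i)),
      integral_congr_ae (ae_restrict_of_ae (hfe (i + 1))), h0]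
  have hsq : ∫ ω, f n ω ^ 2 ∂P ≤ σ ^ 2 := by
    have e : (fun ω => f n ω ^ 2) =ᵐ[P] fun ω => compensated ν N B (upTo H (t n)) ω ^ 2 := by
      filter_upwards [hfe n] with ω hω
      rw [hω]
    rw [integral_congr_ae e, h.integral_compensated_sq hB hBpos hν (measurableSet_upTo hH _)]
    refine le_trans (integral_mono_of_nonneg (ae_of_all _ fun ω => measureReal_nonneg) ?_
      (ae_of_all _ fun ω => ?_)) hHσ
    · refine Integrable.mono' (integrable_const (ν.real B))
        (measurable_real_section_const hν hH').aestronglyMeasurable (ae_of_all _ fun ω => ?_)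
      rw [Real.norm_of_nonneg measureReal_nonneg]
      exact measureReal_mono inter_subset_left hν
    · exact measureReal_mono (inter_subset_inter_right _ (preimage_mono inter_subset_left))
        (measure_ne_top_of_subset inter_subset_left hν)
  refine le_trans (lintegral_mono_ae ?_) (Martingale.lintegral_max_abs_le hmart n (hfL n) hσ hsq)
  filter_upwards [ae_all_iff.2 hfe] with ω hω
  refine Finset.sup_le fun i hi => ?_
  rw [← hω i, Real.enorm_eq_ofReal_abs]
  exact ENNReal.ofReal_le_ofReal (Finset.le_sup' (fun k => |f k ω|) hi)

theorem tendsto_compensated {B : ℕ → Set (ℝ × ℝ)} (hBmono : Monotone B)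
    (hBcover : Ioi 0 ×ˢ univ ⊆ ⋃ j, B j) (hU : U ⊆ univ ×ˢ (Ioi 0 ×ˢ univ)) {ω : Ω}
    (hω : N ω (Prod.mk ω ⁻¹' U) ≠ ∞) (hνω : ν (Prod.mk ω ⁻¹' U) ≠ ∞) (t : ℝ) :
    Tendsto (fun j => compensated ν N (B j) (upTo U t) ω) atTop
      (𝓝 (compensated ν N univ (upTo U t) ω)) := by
  have key : ∀ μ : Measure (ℝ × ℝ), μ (Prod.mk ω ⁻¹' U) ≠ ∞ →
      Tendsto (fun j => μ.real (B j ∩ Prod.mk ω ⁻¹' upTo U t)) atTop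
        (𝓝 (μ.real (univ ∩ Prod.mk ω ⁻¹' upTo U t))) := by
    intro μ hμ
    have e : univ ∩ Prod.mk ω ⁻¹' upTo U t = ⋃ j, B j ∩ Prod.mk ω ⁻¹' upTo U t := by
      rw [← iUnion_inter, univ_inter, eq_comm, inter_eq_right]
      exact fun p hp => hBcover (hU hp.1).2
    have hne : μ (univ ∩ Prod.mk ω ⁻¹' upTo U t) ≠ ∞ :=
      measure_ne_top_of_subset (inter_subset_right.trans (preimage_mono inter_subset_left)) hμ
    refine (ENNReal.tendsto_toReal hne).comp ?_
    rw [e]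
    exact tendsto_measure_iUnion_atTop fun i j hij => inter_subset_inter_left _ (hBmono hij)
  exact (key _ hω).sub (key _ hνω)

/-- The random region need not lie in a fixed set of finite intensity. The bound within `B j` does
not depend on `j`, so it passes to the limit by Fatou's lemma. -/
theorem lintegral_max_compensated_univ_le [SFinite ν] (h : IsAdaptedPoisson P F ν N)
    {B : ℕ → Set (ℝ × ℝ)} (hB : ∀ j, MeasurableSet (B j)) (hBpos : ∀ j, B j ⊆ Ioi 0 ×ˢ univ)
    (hν : ∀ j, ν (B j) ≠ ∞) (hBmono : Monotone B) (hBcover : Ioi 0 ×ˢ univ ⊆ ⋃ j, B j)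
    (hU : MeasurableSet[markedPredictable F] U) (hUpos : U ⊆ univ ×ˢ (Ioi 0 ×ˢ univ))
    (hUfin : ∀ᵐ ω ∂P, N ω (Prod.mk ω ⁻¹' U) ≠ ∞)
    {σ : ℝ} (hσ : 0 < σ) (hUσ : ∫⁻ ω, ν (Prod.mk ω ⁻¹' U) ∂P ≤ ENNReal.ofReal (σ ^ 2))
    {t : ℕ → ℝ} (ht : Monotone t) (ht0 : ∀ i, 0 ≤ t i) (n : ℕ) :
    (∀ i, AEMeasurable (compensated ν N univ (upTo U (t i))) P) ∧
    ∫⁻ ω, (Finset.range (n + 1)).sup (fun i => ‖compensated ν N univ (upTo U (t i)) ω‖ₑ) ∂P ≤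
      ENNReal.ofReal (2 * σ) := by
  have hU' := markedPredictable_le F _ hU
  have hut : ∀ i, MeasurableSet (upTo U (t i)) := fun i =>
    markedPredictable_le F _ (measurableSet_upTo hU (t i))
  have hνU : ∀ᵐ ω ∂P, ν (Prod.mk ω ⁻¹' U) ≠ ∞ := by
    filter_upwards [ae_lt_top (measurable_measure_prodMk_left hU')
      (ne_top_of_le_ne_top ENNReal.ofReal_ne_top hUσ)] with ω hω using hω.ne
  have hlim : ∀ i, ∀ᵐ ω ∂P, Tendsto (fun j => compensated ν N (B j) (upTo U (t i)) ω) atTop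
      (𝓝 (compensated ν N univ (upTo U (t i)) ω)) := by
    intro i
    filter_upwards [hUfin, hνU] with ω h1 h2
    exact tendsto_compensated hBmono hBcover hUpos h1 h2 (t i)
  have hmeas : ∀ j i, AEMeasurable (compensated ν N (B j) (upTo U (t i))) P := fun j i =>
    h.aemeasurable_compensated (hB j) (hν j) (hut i)
  refine ⟨fun i => aemeasurable_of_tendsto_metrizable_ae atTop (fun j => hmeas j i) (hlim i), ?_⟩
  have hle : ∀ j, ∫⁻ ω, (Finset.range (n + 1)).sup
      (fun i => ‖compensated ν N (B j) (upTo U (t i)) ω‖ₑ) ∂P ≤ ENNReal.ofReal (2 * σ) := by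
    intro j
    refine h.lintegral_max_compensated_le (hB j) (hBpos j) (hν j) hU hσ ?_ ht ht0 n
    simp only [measureReal_def]
    rw [integral_toReal]
    · refine ENNReal.toReal_le_of_le_ofReal (sq_nonneg σ) (le_trans ?_ hUσ)
      exact lintegral_mono fun ω => measure_mono inter_subset_right
    · have : ∀ ω, B j ∩ Prod.mk ω ⁻¹' U = Prod.mk ω ⁻¹' (univ ×ˢ B j ∩ U) := by
        intro ω
        ext p
        simp
      simp_rw [this]
      exact (measurable_measure_prodMk_left ((MeasurableSet.univ.prod (hB j)).inter hU')).aemeasurable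
    · filter_upwards [hνU] with ω hω
      exact (measure_mono inter_subset_right).trans_lt (lt_top_iff_ne_top.2 hω)
  calc _ ≤ ∫⁻ ω, liminf (fun j => (Finset.range (n + 1)).sup
        (fun i => ‖compensated ν N (B j) (upTo U (t i)) ω‖ₑ)) atTop ∂P := by
        refine lintegral_mono_ae ?_
        filter_upwards [ae_all_iff.2 hlim] with ω hω
        refine Finset.sup_le fun i hi => ?_
        have h1 : Tendsto (fun j => ‖compensated ν N (B j) (upTo U (t i)) ω‖ₑ) atTop
          (𝓝 ‖compensated ν N univ (upTo U (t i)) ω‖ₑ) := (hω i).enorm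
        rw [← h1.liminf_eq]
        refine liminf_le_liminf (Eventually.of_forall fun j => ?_)
        exact Finset.le_sup (f := fun i => ‖compensated ν N (B j) (upTo U (t i)) ω‖ₑ) hi
    _ ≤ liminf (fun j => ∫⁻ ω, (Finset.range (n + 1)).sup
        (fun i => ‖compensated ν N (B j) (upTo U (t i)) ω‖ₑ) ∂P) atTop := by
        refine lintegral_liminf_le' fun j => ?_
        exact aemeasurable_finset_sup (fun i => (hmeas j i).enorm) _
    _ ≤ _ := by
        refine (liminf_le_liminf (Eventually.of_forall hle)).trans ?_
        rw [liminf_const]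

/-- The maximal inequality along the dyadic points `i T / 2 ^ p` of `[0, T]`. -/
theorem lintegral_iSup_dyadic_compensated_le [SFinite ν] (h : IsAdaptedPoisson P F ν N)
    {B : ℕ → Set (ℝ × ℝ)} (hB : ∀ j, MeasurableSet (B j)) (hBpos : ∀ j, B j ⊆ Ioi 0 ×ˢ univ)
    (hν : ∀ j, ν (B j) ≠ ∞) (hBmono : Monotone B) (hBcover : Ioi 0 ×ˢ univ ⊆ ⋃ j, B j)
    (hU : MeasurableSet[markedPredictable F] U) (hUpos : U ⊆ univ ×ˢ (Ioi 0 ×ˢ univ))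
    (hUfin : ∀ᵐ ω ∂P, N ω (Prod.mk ω ⁻¹' U) ≠ ∞)
    {σ : ℝ} (hσ : 0 < σ) (hUσ : ∫⁻ ω, ν (Prod.mk ω ⁻¹' U) ∂P ≤ ENNReal.ofReal (σ ^ 2))
    {T : ℝ} (hT : 0 ≤ T) :
    AEMeasurable (fun ω => ⨆ p : ℕ, (Finset.range (2 ^ p + 1)).sup
      fun i => ‖compensated ν N univ (upTo U (i * T / 2 ^ p)) ω‖ₑ) P ∧
    ∫⁻ ω, ⨆ p : ℕ, (Finset.range (2 ^ p + 1)).sup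
      (fun i => ‖compensated ν N univ (upTo U (i * T / 2 ^ p)) ω‖ₑ) ∂P ≤
      ENNReal.ofReal (2 * σ) := by
  have key := fun p : ℕ => h.lintegral_max_compensated_univ_le hB hBpos hν hBmono hBcover hU hUpos
    hUfin hσ hUσ (t := fun i : ℕ => i * T / 2 ^ p) (fun i j hij => by dsimp only; gcongr)
    (fun i => by positivity) (2 ^ p)
  have hm : ∀ p : ℕ, AEMeasurable (fun ω => (Finset.range (2 ^ p + 1)).sup
      fun i => ‖compensated ν N univ (upTo U (i * T / 2 ^ p)) ω‖ₑ) P := fun p =>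
    aemeasurable_finset_sup (fun i => ((key p).1 i).enorm) _
  refine ⟨.iSup hm, ?_⟩
  rw [lintegral_iSup' hm]
  · exact iSup_le fun p => (key p).2
  -- The grids are nested, index `i` at level `p` being index `2 * i` at level `p + 1`; monotone
  -- convergence applies.
  · refine ae_of_all _ fun ω => monotone_nat_of_le_succ fun p => Finset.sup_le fun i hi => ?_
    have hi' : 2 * i ∈ Finset.range (2 ^ (p + 1) + 1) := by
      rw [Finset.mem_range] at hi ⊢
      rw [pow_succ]
      omega
    have e : (i : ℝ) * T / 2 ^ p = ((2 * i : ℕ) : ℝ) * T / 2 ^ (p + 1) := by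
      push_cast
      rw [pow_succ]
      field_simp
    rw [e]
    exact Finset.le_sup (f := fun i : ℕ =>
      ‖compensated ν N univ (upTo U (i * T / 2 ^ (p + 1))) ω‖ₑ) hi'

end IsAdaptedPoisson

end UpTo

/-! ### Predictability of left limits and of the rate region -/

section Predictability

variable {Ω E : Type*} [mΩ : MeasurableSpace Ω] {F : Filtration ℝ mΩ}

theorem measurable_time (F : Filtration ℝ mΩ) :
    Measurable[markedPredictable F] fun q : Ω × ℝ × ℝ => q.2.1 := by
  refine measurable_of_Ioi fun s => ?_
  refine MeasurableSpace.measurableSet_generateFrom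
    ⟨s, univ, univ, MeasurableSet.univ, MeasurableSet.univ, ?_⟩
  ext ⟨ω, t, z⟩
  simp

theorem measurable_mark (F : Filtration ℝ mΩ) :
    Measurable[markedPredictable F] fun q : Ω × ℝ × ℝ => q.2.2 := by
  intro C hC
  have : (fun q : Ω × ℝ × ℝ => q.2.2) ⁻¹' C = ⋃ n : ℕ, univ ×ˢ (Ioi (-n : ℝ) ×ˢ C) := by
    ext ⟨ω, t, z⟩
    simp only [mem_preimage, mem_iUnion, mem_prod, mem_univ, mem_Ioi, true_and]
    constructor
    · intro hz
      obtain ⟨n, hn⟩ := exists_nat_gt (-t)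
      exact ⟨n, by linarith, hz⟩
    · rintro ⟨n, -, hz⟩
      exact hz
  rw [this]
  exact @MeasurableSet.iUnion _ _ (markedPredictable F) _ _ fun n =>
    MeasurableSpace.measurableSet_generateFrom ⟨-n, univ, C, MeasurableSet.univ, hC, rfl⟩

/-- The largest point of the grid `2 ^ (-p) ℤ` which is strictly smaller than `s`. -/
noncomputable def gridBelow (p : ℕ) (s : ℝ) : ℝ := (⌈s * 2 ^ p⌉ - 1 : ℤ) / 2 ^ p

theorem gridBelow_lt (p : ℕ) (s : ℝ) : gridBelow p s < s := by
  rw [gridBelow, div_lt_iff₀ (by positivity)]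
  push_cast
  linarith [Int.ceil_lt_add_one (s * 2 ^ p)]

theorem le_gridBelow (p : ℕ) (s : ℝ) : s - (1 / 2) ^ p ≤ gridBelow p s := by
  rw [gridBelow, le_div_iff₀ (by positivity), sub_mul, ← mul_pow]
  push_cast
  norm_num
  exact Int.le_ceil _

theorem gridBelow_nonneg (p : ℕ) {s : ℝ} (hs : 0 < s) : 0 ≤ gridBelow p s := by
  refine div_nonneg ?_ (by positivity)
  have : 0 < ⌈s * 2 ^ p⌉ := Int.ceil_pos.2 (by positivity)
  exact_mod_cast (by omega : 0 ≤ ⌈s * 2 ^ p⌉ - 1)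

theorem tendsto_gridBelow (s : ℝ) : Tendsto (fun p => gridBelow p s) atTop (𝓝[<] s) := by
  refine tendsto_nhdsWithin_iff.2 ⟨?_, Eventually.of_forall fun p => gridBelow_lt p s⟩
  refine tendsto_of_tendsto_of_tendsto_of_le_of_le ?_ tendsto_const_nhds
    (fun p => le_gridBelow p s) (fun p => (gridBelow_lt p s).le)
  have := (tendsto_pow_atTop_nhds_zero_of_lt_one (r := (1 / 2 : ℝ)) (by norm_num)
    (by norm_num)).const_sub s
  simpa using this

/-- Where the grid point is `j / 2 ^ p`, the value is known at that time and the current time is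
strictly later, so the preimage is a union of rectangles cut by conditions on time. -/
theorem measurable_comp_gridBelow [MeasurableSpace E] {Y : ℝ → Ω → E}
    (hY : ∀ t, Measurable[F t] (Y t)) (p : ℕ) :
    Measurable[markedPredictable F] fun q : Ω × ℝ × ℝ => Y (gridBelow p q.2.1) q.1 := by
  intro V hV
  have : (fun q : Ω × ℝ × ℝ => Y (gridBelow p q.2.1) q.1) ⁻¹' V = ⋃ j : ℤ,
      (Y ((j : ℝ) / 2 ^ p) ⁻¹' V) ×ˢ (Ioi ((j : ℝ) / 2 ^ p) ×ˢ univ) ∩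
        {q | ⌈q.2.1 * 2 ^ p⌉ - 1 = j} := by
    ext ⟨ω, s, z⟩
    simp only [mem_preimage, mem_iUnion, mem_inter_iff, mem_prod, mem_Ioi, mem_univ, and_true,
      mem_ofPred_eq]
    constructor
    · intro h
      exact ⟨_, ⟨h, gridBelow_lt p s⟩, rfl⟩
    · rintro ⟨j, ⟨h, -⟩, rfl⟩
      exact h
  rw [this]
  refine @MeasurableSet.iUnion _ _ (markedPredictable F) _ _ fun j =>
    @MeasurableSet.inter _ (markedPredictable F) _ _ ?_ ?_
  · exact MeasurableSpace.measurableSet_generateFrom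
      ⟨_, _, univ, hY _ hV, MeasurableSet.univ, rfl⟩
  · have h1 : Measurable fun s : ℝ => ⌈s * 2 ^ p⌉ - 1 :=
      (measurable_from_top (f := fun j : ℤ => j - 1)).comp (Int.measurable_ceil.comp (by fun_prop))
    exact (h1.comp (measurable_time F)) (measurableSet_singleton j)

variable [NormedAddCommGroup E] [MeasurableSpace E] [BorelSpace E]

/-- The left limit is the limit of the values at the grid points strictly below. -/
theorem measurable_leftLim_time {T : ℝ} {Y : ℝ → Ω → E}
    (hY : ∀ t ∈ Icc 0 T, Measurable[F t] (Y t)) (hr : ∀ ω, IsRcll T fun t => Y t ω) :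
    Measurable[markedPredictable F] fun q : Ω × ℝ × ℝ =>
      (Ioc 0 T).indicator (Function.leftLim fun t => Y t q.1) q.2.1 := by
  classical
  -- Adaptedness is known only on `[0, T]`; the extension by `0` is adapted at all times.
  let Y' : ℝ → Ω → E := fun t ω => if t ∈ Icc 0 T then Y t ω else 0
  have hY' : ∀ t, Measurable[F t] (Y' t) := by
    intro t
    by_cases ht : t ∈ Icc 0 T
    · simpa only [Y', ht, if_true] using hY t ht
    · simpa only [Y', ht, if_false] using measurable_const
  have hS : MeasurableSet[markedPredictable F] {q : Ω × ℝ × ℝ | q.2.1 ∈ Ioc 0 T} :=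
    measurable_time F measurableSet_Ioc
  have hm : ∀ p : ℕ, Measurable[markedPredictable F] fun q : Ω × ℝ × ℝ =>
      if q.2.1 ∈ Ioc 0 T then Y' (gridBelow p q.2.1) q.1 else 0 := fun p =>
    Measurable.ite hS (measurable_comp_gridBelow hY' p) measurable_const
  refine @measurable_of_tendsto_metrizable _ _ (markedPredictable F) _ _ _ _ _ _ hm
    (tendsto_pi_nhds.2 ?_)
  rintro ⟨ω, s, z⟩
  by_cases hs : s ∈ Ioc 0 T
  · simp only [hs, if_true, indicator_of_mem]
    have h1 : ∀ p, Y' (gridBelow p s) ω = Y (gridBelow p s) ω := fun p =>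
      if_pos ⟨gridBelow_nonneg p hs.1, (gridBelow_lt p s).le.trans hs.2⟩
    simp_rw [h1]
    exact (tendsto_leftLim_of_tendsto ((hr ω).2 s hs)).comp (tendsto_gridBelow s)
  · simp only [hs, if_false, not_false_eq_true, indicator_of_notMem]
    exact tendsto_const_nhds

variable [SecondCountableTopology E]

/-- A Carathéodory function, measurable in time and continuous in space; the indicator is there
because continuity is assumed only on `[0, T]`. -/
theorem measurable_rate {T : ℝ} {r : ℝ → E → ℝ} (hr : ∀ x, Measurable fun t => r t x)
    (hc : ∀ t ∈ Icc 0 T, Continuous (r t)) :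
    Measurable fun q : ℝ × E => (Icc 0 T).indicator (fun t => r t q.2) q.1 := by
  have h := measurable_uncurry_of_continuous_of_measurable
    (u := fun (x : E) (t : ℝ) => (Icc 0 T).indicator (fun t => r t x) t) (fun t => by
      by_cases ht : t ∈ Icc 0 T
      · simpa only [ht, indicator_of_mem] using hc t ht
      · simpa only [ht, not_false_eq_true, indicator_of_notMem] using continuous_const)
    (fun x => (hr x).indicator measurableSet_Icc)
  exact h.comp measurable_swap

theorem measurable_rate_leftLim {T : ℝ} {Y : ℝ → Ω → E}
    (hY : ∀ t ∈ Icc 0 T, Measurable[F t] (Y t)) (hYr : ∀ ω, IsRcll T fun t => Y t ω)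
    {r : ℝ → E → ℝ} (hr : ∀ x, Measurable fun t => r t x)
    (hc : ∀ t ∈ Icc 0 T, Continuous (r t)) :
    Measurable[markedPredictable F] fun q : Ω × ℝ × ℝ =>
      (Ioc 0 T).indicator (fun t => r t (Function.leftLim (fun u => Y u q.1) t)) q.2.1 := by
  have hS : MeasurableSet[markedPredictable F] {q : Ω × ℝ × ℝ | q.2.1 ∈ Ioc 0 T} :=
    measurable_time F measurableSet_Ioc
  have h := (measurable_rate hr hc).comp (Measurable.prodMk (measurable_time F)
    (measurable_leftLim_time hY hYr))
  convert h.indicator hS using 2 with q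
  by_cases hq : q.2.1 ∈ Ioc 0 T
  · have hq' : q.2.1 ∈ Icc 0 T := Ioc_subset_Icc_self hq
    rw [indicator_of_mem hq, indicator_of_mem (show q ∈ {q : Ω × ℝ × ℝ | q.2.1 ∈ Ioc 0 T} from hq)]
    simp only [Function.comp, hq, hq', indicator_of_mem]
  · rw [indicator_of_notMem hq,
      indicator_of_notMem (show q ∉ {q : Ω × ℝ × ℝ | q.2.1 ∈ Ioc 0 T} from hq)]

/-- The random region `{(s, z) | 0 < s ≤ T, 0 ≤ z ≤ c r (s, Y (s-))}`. -/
def rateRegion (T c : ℝ) (r : ℝ → E → ℝ) (Y : ℝ → Ω → E) : Set (Ω × ℝ × ℝ) :=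
  {q | q.2.1 ∈ Ioc 0 T ∧ 0 ≤ q.2.2 ∧
    q.2.2 ≤ c * r q.2.1 (Function.leftLim (fun u => Y u q.1) q.2.1)}

theorem measurableSet_rateRegion {T : ℝ} (c : ℝ) {Y : ℝ → Ω → E}
    (hY : ∀ t ∈ Icc 0 T, Measurable[F t] (Y t)) (hYr : ∀ ω, IsRcll T fun t => Y t ω)
    {r : ℝ → E → ℝ} (hr : ∀ x, Measurable fun t => r t x)
    (hc : ∀ t ∈ Icc 0 T, Continuous (r t)) :
    MeasurableSet[markedPredictable F] (rateRegion T c r Y) := by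
  have hS : MeasurableSet[markedPredictable F] {q : Ω × ℝ × ℝ | q.2.1 ∈ Ioc 0 T} :=
    measurable_time F measurableSet_Ioc
  have h0 : MeasurableSet[markedPredictable F] {q : Ω × ℝ × ℝ | 0 ≤ q.2.2} :=
    measurable_mark F measurableSet_Ici
  have h1 : MeasurableSet[markedPredictable F] {q : Ω × ℝ × ℝ | q.2.2 ≤ c *
      (Ioc 0 T).indicator (fun t => r t (Function.leftLim (fun u => Y u q.1) t)) q.2.1} :=
    measurableSet_le (measurable_mark F) ((measurable_rate_leftLim hY hYr hr hc).const_mul c)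
  convert @MeasurableSet.inter _ (markedPredictable F) _ _ hS
    (@MeasurableSet.inter _ (markedPredictable F) _ _ h0 h1) using 1
  ext q
  simp only [rateRegion, mem_ofPred_eq, mem_inter_iff]
  refine and_congr_right fun hq => ?_
  rw [indicator_of_mem hq]

end Predictability

/-! ### Intensity of the region under a graph -/

section Intensity

variable {T a : ℝ}

instance sFinite_intensity (T a : ℝ) : SFinite (intensity T a) := by
  unfold intensity
  infer_instance

theorem intensity_box_ne_top (T a : ℝ) (j : ℕ) :
    intensity T a (Ioi 0 ×ˢ Icc (-j : ℝ) j) ≠ ∞ := by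
  rw [intensity, Measure.smul_apply, Measure.prod_prod, smul_eq_mul]
  refine ENNReal.mul_ne_top ENNReal.ofReal_ne_top (ENNReal.mul_ne_top ?_ ?_)
  · exact measure_ne_top _ _
  · exact ((Measure.restrict_apply_le _ _).trans_lt measure_Icc_lt_top).ne

/-- By Tonelli, the slice at `s` is `Icc 0 (φ s)`; it is empty when `φ s < 0`, in accordance with
`ENNReal.ofReal`. -/
theorem intensity_underGraph {φ : ℝ → ℝ} {t : ℝ} (ht : t ≤ T)
    (hφ : MeasurableSet (underGraph φ t)) :
    intensity T a (underGraph φ t) = ENNReal.ofReal a * ∫⁻ s in Ioc 0 t, ENNReal.ofReal (φ s) := by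
  rw [intensity, Measure.smul_apply, smul_eq_mul, Measure.prod_apply hφ]
  congr 1
  have e : ∀ s, ((volume : Measure ℝ).restrict (Ici 0)) (Prod.mk s ⁻¹' underGraph φ t) =
      (Ioc 0 t).indicator (fun s => ENNReal.ofReal (φ s)) s := by
    intro s
    rw [Measure.restrict_apply (measurable_prodMk_left hφ)]
    by_cases hs : s ∈ Ioc 0 t
    · have : Prod.mk s ⁻¹' underGraph φ t ∩ Ici 0 = Icc 0 (φ s) := by
        ext z
        simp only [underGraph, mem_inter_iff, mem_preimage, mem_ofPred_eq, mem_Ici, mem_Icc,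
          hs.1, hs.2, true_and]
        tauto
      rw [this, Real.volume_Icc, sub_zero, indicator_of_mem hs]
    · have : Prod.mk s ⁻¹' underGraph φ t = ∅ := by
        ext z
        simp only [underGraph, mem_preimage, mem_ofPred_eq, mem_empty_iff_false, iff_false]
        exact fun h => hs ⟨h.1, h.2.1⟩
      rw [this, empty_inter, measure_empty, indicator_of_notMem hs]
  simp_rw [e]
  rw [lintegral_indicator measurableSet_Ioc, Measure.restrict_restrict measurableSet_Ioc,
    inter_eq_left.2 (Ioc_subset_Icc_self.trans (Icc_subset_Icc_right ht))]

end Intensity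

/-! ### Regularity of rcll paths -/

section Paths

/-- At a jump time, choose a point `x` of a countable dense set much closer to `w t` than to the
left limit. Then `-dist (w ·) x` jumps up at `t` from a rational left neighbourhood, which a real
function can do only countably often. -/
theorem countable_leftLim_ne {E : Type*} [MetricSpace E] [SecondCountableTopology E] (w : ℝ → E) :
    {t | ∃ l, Tendsto w (𝓝[<] t) (𝓝 l) ∧ l ≠ w t}.Countable := by
  rcases isEmpty_or_nonempty E with hE | hE
  · exact (Set.to_countable ∅).mono fun t _ => (IsEmpty.false (w t)).elim
  refine Set.Countable.mono (s₂ := ⋃ (i : ℕ) (q : ℚ), {t | t ∈ Ioi (q : ℝ) ∧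
    ∃ z < -dist (w t) (TopologicalSpace.denseSeq E i),
      ∀ y ∈ Ioi (q : ℝ), y < t → -dist (w y) (TopologicalSpace.denseSeq E i) ≤ z}) ?_
    (countable_iUnion fun i => countable_iUnion fun q =>
      countable_image_lt_image_Iio_within (Ioi (q : ℝ))
        fun t => -dist (w t) (TopologicalSpace.denseSeq E i))
  rintro t ⟨l, hl, hne⟩
  have hd : 0 < dist l (w t) := dist_pos.2 hne
  obtain ⟨i, hi⟩ := (TopologicalSpace.denseRange_denseSeq E).exists_dist_lt (w t)
    (half_pos (half_pos hd))
  set x := TopologicalSpace.denseSeq E i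
  have hlx : 3 * (dist l (w t) / 4) < dist l x := by
    have := dist_triangle l x (w t)
    rw [dist_comm x] at this
    linarith
  have hev : ∀ᶠ y in 𝓝[<] t, dist l (w t) / 2 < dist (w y) x :=
    (hl.dist tendsto_const_nhds).eventually (lt_mem_nhds (by linarith))
  obtain ⟨b, hb, hbt⟩ := (mem_nhdsLT_iff_exists_Ioo_subset).1 hev
  obtain ⟨q, hbq, hqt⟩ := exists_rat_btwn (mem_Iio.1 hb)
  refine mem_iUnion₂.2 ⟨i, q, hqt, -(dist l (w t) / 2), ?_, ?_⟩
  · linarith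
  · intro y hy hyt
    have : dist l (w t) / 2 < dist (w y) x := hbt ⟨hbq.trans hy, hyt⟩
    exact neg_le_neg this.le

variable {E : Type*} [NormedAddCommGroup E] {T : ℝ} {w : ℝ → E}

theorem IsRcll.ae_leftLim_eq [SecondCountableTopology E] (hw : IsRcll T w) :
    ∀ᵐ t ∂(volume.restrict (Ioc 0 T)), Function.leftLim w t = w t := by
  have h := (countable_leftLim_ne w).ae_notMem volume
  filter_upwards [ae_restrict_of_ae h, ae_restrict_mem measurableSet_Ioc] with t ht htT
  by_contra hne
  exact ht ⟨_, tendsto_leftLim_of_tendsto (hw.2 t htT), hne⟩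

theorem IsRcll.continuousWithinAt (hw : IsRcll T w) {t : ℝ} (ht : t ∈ Icc 0 T) :
    ContinuousWithinAt w (Icc t T) t := by
  rcases ht.2.eq_or_lt with rfl | h
  · rw [Icc_self]
    exact continuousWithinAt_singleton
  · exact (hw.1 t ⟨ht.1, h⟩).mono Icc_subset_Ici_self

theorem IsRcll.exists_norm_le (hw : IsRcll T w) : ∃ C, ∀ t ∈ Icc 0 T, ‖w t‖ ≤ C := by
  refine isCompact_Icc.induction_on (p := fun s => ∃ C, ∀ t ∈ s, ‖w t‖ ≤ C) ⟨0, by simp⟩ ?_ ?_ ?_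
  · rintro s t hst ⟨C, hC⟩
    exact ⟨C, fun u hu => hC u (hst hu)⟩
  · rintro s t ⟨C, hC⟩ ⟨D, hD⟩
    exact ⟨max C D, fun u hu => hu.elim (fun h => (hC u h).trans (le_max_left _ _))
      fun h => (hD u h).trans (le_max_right _ _)⟩
  · intro t ht
    have h1 : ∃ C, ∀ᶠ u in 𝓝[Icc t T] t, ‖w u‖ ≤ C :=
      ⟨‖w t‖ + 1, (hw.continuousWithinAt ht).norm.eventually (ge_mem_nhds (by linarith))⟩
    have h2 : ∃ C, ∀ᶠ u in 𝓝[Ico 0 t] t, ‖w u‖ ≤ C := by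
      rcases ht.1.eq_or_lt with rfl | h0
      · exact ⟨0, by simp⟩
      · obtain ⟨l, hl⟩ := hw.2 t ⟨h0, ht.2⟩
        exact ⟨‖l‖ + 1, (nhdsWithin_mono t Ico_subset_Iio_self)
          (hl.norm.eventually (ge_mem_nhds (by linarith)))⟩
    obtain ⟨C, hC⟩ := h1
    obtain ⟨D, hD⟩ := h2
    refine ⟨{u | ‖w u‖ ≤ max C D}, ?_, max C D, fun u hu => hu⟩
    rw [← Ico_union_Icc_eq_Icc ht.1 ht.2, nhdsWithin_union]
    exact ⟨hD.mono fun u hu => hu.trans (le_max_right _ _),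
      hC.mono fun u hu => hu.trans (le_max_left _ _)⟩

end Paths

/-! ### Grönwall's lemma and extension from dyadic times -/

section Gronwall

/-- As `f` is only right continuous, Grönwall is applied to its primitive, whose right derivative is
`f`. -/
theorem le_mul_exp_of_le_add_integral {f : ℝ → ℝ} {T a C : ℝ} (hf0 : ∀ t, 0 ≤ f t) (hC : 0 < C)
    (hfi : IntervalIntegrable f volume 0 T)
    (hfc : ∀ t ∈ Ico 0 T, ContinuousWithinAt f (Ici t) t)
    (hf : ∀ t ∈ Icc 0 T, f t ≤ a + C * ∫ s in (0 : ℝ)..t, f s) {t : ℝ} (ht : t ∈ Icc 0 T) :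
    f t ≤ a * Real.exp (C * t) := by
  have hT : 0 ≤ T := ht.1.trans ht.2
  have hg0 : ∀ x, 0 ≤ x → 0 ≤ ∫ s in (0 : ℝ)..x, f s := fun x hx =>
    intervalIntegral.integral_nonneg hx fun s _ => hf0 s
  have hcont : ContinuousOn (fun x => ∫ s in (0 : ℝ)..x, f s) (Icc 0 T) := by
    have h := intervalIntegral.continuousOn_primitive_interval' hfi left_mem_uIcc
    rwa [uIcc_of_le hT] at h
  have hsub : ∀ x ∈ Icc 0 T, IntervalIntegrable f volume 0 x := fun x hx =>
    hfi.mono_set (by rw [uIcc_of_le hx.1, uIcc_of_le hT]; exact Icc_subset_Icc_right hx.2)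
  have h := norm_le_gronwallBound_of_norm_deriv_right_le (f' := f) (δ := 0) (K := C) (ε := a)
    hcont (fun x hx => by
      refine intervalIntegral.integral_hasDerivWithinAt_right (t := Ioi x)
        (hsub x ⟨hx.1, hx.2.le⟩) ?_ ((hfc x hx).mono Ioi_subset_Ici_self)
      refine ⟨Ioo x T, Ioo_mem_nhdsGT hx.2, ?_⟩
      have h1 := (intervalIntegrable_iff_integrableOn_Ioc_of_le hT).1 hfi
      exact (h1.mono_set (Ioo_subset_Ioc_self.trans
        (Ioc_subset_Ioc_left hx.1))).aestronglyMeasurable)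
    (by simp) (fun x hx => by
      rw [Real.norm_of_nonneg (hf0 x), Real.norm_of_nonneg (hg0 x hx.1)]
      linarith [hf x ⟨hx.1, hx.2.le⟩]) t ht
  rw [Real.norm_of_nonneg (hg0 t ht.1), gronwallBound_of_K_ne_0 hC.ne', sub_zero] at h
  have h2 := hf t ht
  have h3 : C * ∫ s in (0 : ℝ)..t, f s ≤ C * (0 * Real.exp (C * t) +
    a / C * (Real.exp (C * t) - 1)) := mul_le_mul_of_nonneg_left h hC.le
  have h4 : C * (0 * Real.exp (C * t) + a / C * (Real.exp (C * t) - 1)) =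
      a * Real.exp (C * t) - a := by
    field_simp
    ring
  linarith

/-- Rounding `t` up to the dyadic grid approaches it from the right, where `f` is continuous. -/
theorem le_of_le_on_dyadic {f g : ℝ → ℝ} {T : ℝ} (hT : 0 < T)
    (hf : ∀ t ∈ Icc 0 T, ContinuousWithinAt f (Icc t T) t) (hg : ContinuousOn g (Icc 0 T))
    (hfg : ∀ p i : ℕ, i ≤ 2 ^ p → f (i * T / 2 ^ p) ≤ g (i * T / 2 ^ p)) {t : ℝ}
    (ht : t ∈ Icc 0 T) : f t ≤ g t := by
  have hx0 : ∀ p : ℕ, 0 ≤ t * 2 ^ p / T := fun p => by have := ht.1; positivity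
  have h1 : ∀ p : ℕ, ⌈t * 2 ^ p / T⌉₊ ≤ 2 ^ p := by
    intro p
    rw [Nat.ceil_le, div_le_iff₀ hT]
    push_cast
    nlinarith [ht.2, pow_pos (two_pos (α := ℝ)) p]
  have h2 : ∀ p : ℕ, t ≤ (⌈t * 2 ^ p / T⌉₊ : ℝ) * T / 2 ^ p := by
    intro p
    rw [le_div_iff₀ (by positivity), ← div_le_iff₀ hT]
    exact Nat.le_ceil _
  have h3 : ∀ p : ℕ, (⌈t * 2 ^ p / T⌉₊ : ℝ) * T / 2 ^ p ≤ T := by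
    intro p
    rw [div_le_iff₀ (by positivity), mul_comm]
    gcongr
    exact_mod_cast h1 p
  have h4 : ∀ p : ℕ, (⌈t * 2 ^ p / T⌉₊ : ℝ) * T / 2 ^ p ≤ t + T * (1 / 2) ^ p := by
    intro p
    have := (Nat.ceil_lt_add_one (hx0 p)).le
    calc (⌈t * 2 ^ p / T⌉₊ : ℝ) * T / 2 ^ p ≤ (t * 2 ^ p / T + 1) * T / 2 ^ p := by gcongr
      _ = _ := by
        rw [one_div, inv_pow]
        field_simp
  have hlim : Tendsto (fun p : ℕ => (⌈t * 2 ^ p / T⌉₊ : ℝ) * T / 2 ^ p) atTop (𝓝[Icc t T] t) := by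
    refine tendsto_nhdsWithin_iff.2 ⟨?_, Eventually.of_forall fun p => ⟨h2 p, h3 p⟩⟩
    refine tendsto_of_tendsto_of_tendsto_of_le_of_le tendsto_const_nhds ?_ h2 h4
    have := ((tendsto_pow_atTop_nhds_zero_of_lt_one (r := (1 / 2 : ℝ)) (by norm_num)
      (by norm_num)).const_mul T).const_add t
    simpa using this
  exact le_of_tendsto_of_tendsto' ((hf t ht).tendsto.comp hlim)
    (((hg t ht).mono (Icc_subset_Icc_left ht.1)).tendsto.comp hlim) fun p => hfg p _ (h1 p)

end Gronwall

/-! ### Deterministic comparison with the fluid limit -/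

section PathBound

variable {E : Type*} [NormedAddCommGroup E] [NormedSpace ℝ E] {m : ℕ} {T : ℝ}

/-- The noise is controlled only at dyadic times. The integral inequality is proved there and
extended by right continuity, after which Grönwall applies. -/
theorem norm_sub_le_of_dyadic (hT : 0 < T) {ζ : Fin m → E} {r : Fin m → ℝ → E → ℝ}
    {L : Fin m → ℝ≥0} (hL : ∀ k, ∀ t ∈ Icc 0 T, LipschitzWith (L k) (r k t)) {Λ w : ℝ → E}
    (hΛ : IsFluidLimit T ζ r Λ) (hw : IsRcll T w)
    (hwm : AEStronglyMeasurable w (volume.restrict (Ioc 0 T)))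
    (hwi : ∀ k, IntervalIntegrable (fun s => r k s (w s)) volume 0 T)
    {n : ℝ} (hn : 0 < n) {x : Fin m → ℝ → ℝ} {S : Fin m → ℝ}
    (hsde : ∀ t ∈ Icc 0 T, w t = w 0 + n⁻¹ • ∑ k, x k t • ζ k)
    (hS : ∀ k, ∀ p i : ℕ, i ≤ 2 ^ p →
      |x k (i * T / 2 ^ p) - n * ∫ s in (0 : ℝ)..(i * T / 2 ^ p), r k s (w s)| ≤ S k)
    {C : ℝ} (hC0 : 0 < C) (hC : ∑ k, (L k : ℝ) * ‖ζ k‖ ≤ C) {t : ℝ} (ht : t ∈ Icc 0 T) :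
    ‖w t - Λ t‖ ≤ (‖w 0 - Λ 0‖ + n⁻¹ * ∑ k, S k * ‖ζ k‖) * Real.exp (C * t) := by
  have hTle := hT.le
  obtain ⟨D, hD⟩ := hw.exists_norm_le
  obtain ⟨D', hD'⟩ := isCompact_Icc.exists_bound_of_continuousOn hΛ.continuousOn
  have hfc : ∀ t ∈ Icc 0 T, ContinuousWithinAt (fun s => ‖w s - Λ s‖) (Icc t T) t := fun t ht =>
    ((hw.continuousWithinAt ht).sub
      ((hΛ.continuousOn t ht).mono (Icc_subset_Icc_left ht.1))).norm
  have hfi : IntervalIntegrable (fun s => ‖w s - Λ s‖) volume 0 T := by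
    rw [intervalIntegrable_iff_integrableOn_Ioc_of_le hTle]
    refine Integrable.of_bound (C := D + D') (hwm.sub ((hΛ.continuousOn.mono
      Ioc_subset_Icc_self).aestronglyMeasurable measurableSet_Ioc)).norm ?_
    filter_upwards [ae_restrict_mem measurableSet_Ioc] with s hs
    rw [norm_norm]
    exact (norm_sub_le _ _).trans
      (add_le_add (hD s (Ioc_subset_Icc_self hs)) (hD' s (Ioc_subset_Icc_self hs)))
  have hsub : ∀ {f : ℝ → ℝ}, IntervalIntegrable f volume 0 T → ∀ u ∈ Icc 0 T,
      IntervalIntegrable f volume 0 u := fun hf u hu =>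
    hf.mono_set (by rw [uIcc_of_le hu.1, uIcc_of_le hTle]; exact Icc_subset_Icc_right hu.2)
  have hdy : ∀ p i : ℕ, i ≤ 2 ^ p → ‖w (i * T / 2 ^ p) - Λ (i * T / 2 ^ p)‖ ≤
      (‖w 0 - Λ 0‖ + n⁻¹ * ∑ k, S k * ‖ζ k‖) +
        C * ∫ s in (0 : ℝ)..(i * T / 2 ^ p), ‖w s - Λ s‖ := by
    intro p i hi
    have hu : (i * T / 2 ^ p : ℝ) ∈ Icc 0 T := by
      refine ⟨by positivity, ?_⟩
      rw [div_le_iff₀ (by positivity), mul_comm]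
      gcongr
      exact_mod_cast hi
    have hSi := fun k => hS k p i hi
    generalize (i * T / 2 ^ p : ℝ) = u at hu hSi
    have hdiff : ∀ k, |(∫ s in (0 : ℝ)..u, r k s (w s)) - ∫ s in (0 : ℝ)..u, r k s (Λ s)| ≤
        L k * ∫ s in (0 : ℝ)..u, ‖w s - Λ s‖ := by
      intro k
      have i1 := hsub (hwi k) u hu
      have i2 := hsub (hΛ.integrable k) u hu
      rw [← intervalIntegral.integral_sub i1 i2, ← intervalIntegral.integral_const_mul]
      refine (intervalIntegral.abs_integral_le_integral_abs hu.1).trans ?_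
      refine intervalIntegral.integral_mono_on hu.1 (i1.sub i2).abs ((hsub hfi u hu).const_mul _)
        fun s hs => ?_
      have := (hL k s ⟨hs.1, hs.2.trans hu.2⟩).dist_le_mul (w s) (Λ s)
      rwa [dist_eq_norm, dist_eq_norm, Real.norm_eq_abs] at this
    have hI0 : 0 ≤ ∫ s in (0 : ℝ)..u, ‖w s - Λ s‖ :=
      intervalIntegral.integral_nonneg hu.1 fun s _ => norm_nonneg _
    -- Initial deviation, noise, and difference of the drifts.
    have hdec : w u - Λ u = (w 0 - Λ 0) +
        n⁻¹ • ∑ k, (x k u - n * ∫ s in (0 : ℝ)..u, r k s (w s)) • ζ k +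
        ∑ k, ((∫ s in (0 : ℝ)..u, r k s (w s)) - ∫ s in (0 : ℝ)..u, r k s (Λ s)) • ζ k := by
      rw [hsde u hu, hΛ.eq u hu]
      simp only [sub_smul, Finset.sum_sub_distrib, smul_sub, mul_smul, ← Finset.smul_sum,
        inv_smul_smul₀ hn.ne']
      abel
    have b1 : ‖∑ k, (x k u - n * ∫ s in (0 : ℝ)..u, r k s (w s)) • ζ k‖ ≤ ∑ k, S k * ‖ζ k‖ := by
      refine norm_sum_le_of_le _ fun k _ => ?_
      rw [norm_smul, Real.norm_eq_abs]
      exact mul_le_mul_of_nonneg_right (hSi k) (norm_nonneg _)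
    have b2 : ‖∑ k, ((∫ s in (0 : ℝ)..u, r k s (w s)) - ∫ s in (0 : ℝ)..u, r k s (Λ s)) • ζ k‖ ≤
        C * ∫ s in (0 : ℝ)..u, ‖w s - Λ s‖ := by
      refine (norm_sum_le_of_le (f := fun k => ((∫ s in (0 : ℝ)..u, r k s (w s)) -
        ∫ s in (0 : ℝ)..u, r k s (Λ s)) • ζ k)
        (n := fun k => (L k : ℝ) * ‖ζ k‖ * ∫ s in (0 : ℝ)..u, ‖w s - Λ s‖) _ fun k _ => ?_).trans ?_
      · rw [norm_smul, Real.norm_eq_abs, mul_right_comm]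
        exact mul_le_mul_of_nonneg_right (hdiff k) (norm_nonneg _)
      · rw [← Finset.sum_mul]
        exact mul_le_mul_of_nonneg_right hC hI0
    rw [hdec]
    refine (norm_add_le _ _).trans (add_le_add ((norm_add_le _ _).trans (add_le_add le_rfl ?_)) b2)
    rw [norm_smul, Real.norm_of_nonneg (inv_nonneg.2 hn.le)]
    exact mul_le_mul_of_nonneg_left b1 (inv_nonneg.2 hn.le)
  have hcont : ContinuousOn (fun u => (‖w 0 - Λ 0‖ + n⁻¹ * ∑ k, S k * ‖ζ k‖) +
      C * ∫ s in (0 : ℝ)..u, ‖w s - Λ s‖) (Icc 0 T) := by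
    have h := intervalIntegral.continuousOn_primitive_interval' hfi left_mem_uIcc
    rw [uIcc_of_le hTle] at h
    exact continuousOn_const.add (continuousOn_const.mul h)
  refine le_mul_exp_of_le_add_integral (f := fun s => ‖w s - Λ s‖) (fun s => norm_nonneg _) hC0 hfi
    (fun s hs => (hfc s ⟨hs.1, hs.2.le⟩).mono_of_mem_nhdsWithin (Icc_mem_nhdsGE hs.2))
    (fun s hs => ?_) ht
  exact le_of_le_on_dyadic hT hfc hcont hdy hs

end PathBound

/-! ### Noise and deviation of the scaled process -/

section ScaledProcess

variable {Ω E : Type*} [mΩ : MeasurableSpace Ω] [NormedAddCommGroup E] [NormedSpace ℝ E]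
  [MeasurableSpace E] [BorelSpace E] [SecondCountableTopology E] {m : ℕ} {P : Measure Ω}
  {T : ℝ} {ζ : Fin m → E} {α : Fin m → ℝ} {ρ : Fin m → ℝ → (ℝ → E) → ℝ}
  {F : Filtration ℝ mΩ} {N : Fin m → Ω → Measure (ℝ × ℝ)} {Y : ℝ → Ω → E} {n : ℕ}

theorem IsScaledProcess.aestronglyMeasurable_path (hX : IsScaledProcess P T ζ α n ρ F N Y)
    (ω : Ω) : AEStronglyMeasurable (fun t => Y t ω) (volume.restrict (Ioc 0 T)) := by
  have h1 := (measurable_leftLim_time hX.adapted hX.rcll).mono (markedPredictable_le F) le_rfl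
  have h2 : Measurable fun s : ℝ =>
      (Ioc 0 T).indicator (Function.leftLim fun t => Y t ω) s :=
    h1.comp (measurable_prodMk_left.comp (measurable_id.prodMk measurable_const) :
      Measurable fun s : ℝ => (ω, s, (0 : ℝ)))
  refine h2.aestronglyMeasurable.congr ?_
  filter_upwards [(hX.rcll ω).ae_leftLim_eq, ae_restrict_mem measurableSet_Ioc] with s hs hsT
  rw [indicator_of_mem hsT, hs]

variable [IsProbabilityMeasure P]

/-- The compensated jump counts along the dyadic times are dominated by a random variable whose
mean is of order `√n`. -/
theorem IsScaledProcess.exists_dyadic_bound (hT : 0 < T)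
    (hX : IsScaledProcess P T ζ α n ρ F N Y) (hn : 1 ≤ n) (k : Fin m) {r : ℝ → E → ℝ}
    (hrm : ∀ x, Measurable fun t => r t x) (hrc : ∀ t ∈ Icc 0 T, Continuous (r t))
    (hscal : ∀ w : ℝ → E, IsRcll T w → ∀ t ∈ Ioc 0 T,
      (n : ℝ) ^ (α k - 1) * ρ k t (fun u => (n : ℝ) • w u) = r t (Function.leftLim w t))
    {κ : ℝ≥0} (hκ : ∫⁻ ω, ⨆ t ∈ Icc 0 T, ‖r t (Y t ω)‖ₑ ∂P ≤ κ) :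
    ∃ S : Ω → ℝ≥0∞, AEMeasurable S P ∧
      ∫⁻ ω, S ω ∂P ≤ ENNReal.ofReal (2 * √(n * (T * κ + 1))) ∧
      ∀ᵐ ω ∂P, IntervalIntegrable (fun s => r s (Y s ω)) volume 0 T ∧
        ∀ p i : ℕ, i ≤ 2 ^ p →
          ‖(N k ω (underGraph (fun s => ρ k s (fun u => (n : ℝ) • Y u ω))
              (i * T / 2 ^ p))).toReal -
            n * ∫ s in (0 : ℝ)..(i * T / 2 ^ p), r s (Y s ω)‖ₑ ≤ S ω := by
  have hn0 : (0 : ℝ) < n := by exact_mod_cast hn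
  have hT0 := hT.le
  set ν := intensity T ((n : ℝ) ^ α k) with hνdef
  set U := rateRegion T ((n : ℝ) ^ (1 - α k)) r Y with hUdef
  have hpois : IsAdaptedPoisson P F ν (N k) := hX.poisson.isAdaptedPoisson k
  have hU : MeasurableSet[markedPredictable F] U :=
    measurableSet_rateRegion _ hX.adapted hX.rcll hrm hrc
  have hρ : ∀ ω, ∀ s ∈ Ioc 0 T, ρ k s (fun u => (n : ℝ) • Y u ω) =
      (n : ℝ) ^ (1 - α k) * r s (Function.leftLim (fun u => Y u ω) s) := by
    intro ω s hs
    rw [← hscal _ (hX.rcll ω) s hs, ← mul_assoc, ← Real.rpow_add hn0]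
    simp
  have hsec : ∀ ω, ∀ t ≤ T, Prod.mk ω ⁻¹' upTo U t =
      underGraph (fun s => ρ k s (fun u => (n : ℝ) • Y u ω)) t := by
    intro ω t ht
    ext ⟨s, z⟩
    simp only [upTo, hUdef, rateRegion, mem_preimage, mem_inter_iff, mem_ofPred_eq, underGraph,
      mem_Ioc]
    constructor
    · rintro ⟨⟨h1, h2, h3⟩, h4⟩
      exact ⟨h1.1, h4, h2, by rwa [hρ ω s h1]⟩
    · rintro ⟨h1, h2, h3, h4⟩
      have hs : s ∈ Ioc 0 T := ⟨h1, h2.trans ht⟩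
      exact ⟨⟨hs, h3, by rwa [hρ ω s hs] at h4⟩, h2⟩
  have hsecT : ∀ ω, Prod.mk ω ⁻¹' U =
      underGraph (fun s => ρ k s (fun u => (n : ℝ) • Y u ω)) T := by
    intro ω
    rw [← hsec ω T le_rfl]
    congr 1
    exact (inter_eq_left.2 fun q hq => hq.1.2).symm
  -- The powers combine as `n ^ α k * n ^ (1 - α k) = n`, and left limits may be replaced by values
  -- because jump times are countable.
  have hνsec : ∀ ω, ∀ t ≤ T, ν (Prod.mk ω ⁻¹' upTo U t) =
      ENNReal.ofReal n * ∫⁻ s in Ioc 0 t, ENNReal.ofReal (r s (Y s ω)) := by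
    intro ω t ht
    have hm : MeasurableSet (Prod.mk ω ⁻¹' upTo U t) :=
      measurable_prodMk_left (markedPredictable_le F _ (measurableSet_upTo hU t))
    rw [hsec ω t ht] at hm ⊢
    rw [hνdef, intensity_underGraph ht hm]
    have e : ∫⁻ s in Ioc 0 t, ENNReal.ofReal (ρ k s fun u => (n : ℝ) • Y u ω) =
        ∫⁻ s in Ioc 0 t, ENNReal.ofReal ((n : ℝ) ^ (1 - α k)) * ENNReal.ofReal (r s (Y s ω)) := by
      refine lintegral_congr_ae ?_
      filter_upwards [ae_restrict_of_ae_restrict_of_subset (Ioc_subset_Ioc_right ht)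
        (hX.rcll ω).ae_leftLim_eq, ae_restrict_mem measurableSet_Ioc] with s hs hst
      rw [hρ ω s ⟨hst.1, hst.2.trans ht⟩, hs, ENNReal.ofReal_mul (by positivity)]
    rw [e, lintegral_const_mul' _ _ ENNReal.ofReal_ne_top, ← mul_assoc,
      ← ENNReal.ofReal_mul (by positivity), ← Real.rpow_add hn0]
    simp
  have hupT : ∀ ω, Prod.mk ω ⁻¹' U = Prod.mk ω ⁻¹' upTo U T := fun ω => by
    rw [hsecT, hsec ω T le_rfl]
  -- The summand `1` only keeps `σ` positive when `κ = 0`.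
  have hmean : ∫⁻ ω, ν (Prod.mk ω ⁻¹' U) ∂P ≤
      ENNReal.ofReal (√(n * (T * κ + 1)) ^ 2) := by
    have hκT : ∫⁻ ω, (∫⁻ s in Ioc 0 T, ENNReal.ofReal (r s (Y s ω))) ∂P ≤
        ENNReal.ofReal T * κ := by
      calc _ ≤ ∫⁻ ω, ENNReal.ofReal T * ⨆ t ∈ Icc 0 T, ‖r t (Y t ω)‖ₑ ∂P := by
            refine lintegral_mono fun ω => ?_
            calc _ ≤ ∫⁻ s in Ioc 0 T, ⨆ t ∈ Icc 0 T, ‖r t (Y t ω)‖ₑ := by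
                  refine setLIntegral_mono' measurableSet_Ioc fun s hs => ?_
                  refine le_trans ?_ (le_iSup₂ (f := fun t (_ : t ∈ Icc 0 T) => ‖r t (Y t ω)‖ₑ) s
                    (Ioc_subset_Icc_self hs))
                  rw [Real.enorm_eq_ofReal_abs]
                  exact ENNReal.ofReal_le_ofReal (le_abs_self _)
              _ = _ := by
                  rw [setLIntegral_const, Real.volume_Ioc, sub_zero, mul_comm]
        _ = ENNReal.ofReal T * ∫⁻ ω, ⨆ t ∈ Icc 0 T, ‖r t (Y t ω)‖ₑ ∂P :=
            lintegral_const_mul' _ _ ENNReal.ofReal_ne_top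
        _ ≤ _ := by gcongr
    simp_rw [hupT, fun ω => hνsec ω T le_rfl]
    rw [lintegral_const_mul' _ _ ENNReal.ofReal_ne_top, Real.sq_sqrt (by positivity),
      ENNReal.ofReal_mul hn0.le]
    refine mul_le_mul_right (hκT.trans ?_) _
    rw [← ENNReal.ofReal_coe_nnreal, ← ENNReal.ofReal_mul hT0]
    exact ENNReal.ofReal_le_ofReal (by linarith)
  have hfin : ∀ᵐ ω ∂P, N k ω (Prod.mk ω ⁻¹' U) ≠ ∞ := by
    filter_upwards [hX.finite] with ω hω
    rw [hsecT]
    exact hω k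
  have hσ : 0 < √(n * (T * κ + 1)) := Real.sqrt_pos.2 (by positivity)
  obtain ⟨hSm, hSle⟩ := hpois.lintegral_iSup_dyadic_compensated_le
    (B := fun j : ℕ => Ioi 0 ×ˢ Icc (-j : ℝ) j)
    (fun j => measurableSet_Ioi.prod measurableSet_Icc)
    (fun j => prod_mono le_rfl (subset_univ _))
    (fun j => intensity_box_ne_top T _ j)
    (fun i j hij => prod_mono le_rfl (by
      have : (i : ℝ) ≤ j := by exact_mod_cast hij
      exact Icc_subset_Icc (by linarith) this))
    (by
      rintro ⟨s, z⟩ ⟨hs, -⟩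
      obtain ⟨j, hj⟩ := exists_nat_ge |z|
      exact mem_iUnion.2 ⟨j, hs, abs_le.1 hj⟩)
    hU (fun q hq => ⟨trivial, hq.1.1, trivial⟩) hfin hσ hmean hT0
  refine ⟨_, hSm, hSle, ?_⟩
  have hνfin : ∀ᵐ ω ∂P, ν (Prod.mk ω ⁻¹' U) < ∞ :=
    ae_lt_top (measurable_measure_prodMk_left (markedPredictable_le F _ hU))
      (ne_top_of_le_ne_top ENNReal.ofReal_ne_top hmean)
  filter_upwards [hνfin, hX.rate_nonneg] with ω hω hnonneg
  -- The intensity sees only the positive part of `r`; nonnegativity makes it the compensator `n ∫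
  -- r`.
  have hpos : ∀ᵐ s ∂(volume.restrict (Ioc 0 T)), 0 ≤ r s (Y s ω) := by
    filter_upwards [(hX.rcll ω).ae_leftLim_eq, ae_restrict_mem measurableSet_Ioc] with s hs hsT
    have h1 := hnonneg k s hsT
    rw [hρ ω s hsT, hs] at h1
    exact nonneg_of_mul_nonneg_right h1 (by positivity)
  have hmeas : AEStronglyMeasurable (fun s => r s (Y s ω)) (volume.restrict (Ioc 0 T)) := by
    have h1 := (measurable_rate_leftLim hX.adapted hX.rcll hrm hrc).mono
      (markedPredictable_le F) le_rfl
    have h2 : Measurable fun s : ℝ => (Ioc 0 T).indicator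
        (fun t => r t (Function.leftLim (fun u => Y u ω) t)) s :=
      h1.comp (measurable_prodMk_left.comp (measurable_id.prodMk measurable_const) :
        Measurable fun s : ℝ => (ω, s, (0 : ℝ)))
    refine h2.aestronglyMeasurable.congr ?_
    filter_upwards [(hX.rcll ω).ae_leftLim_eq, ae_restrict_mem measurableSet_Ioc] with s hs hsT
    rw [indicator_of_mem hsT, hs]
  have hlt : ∫⁻ s in Ioc 0 T, ENNReal.ofReal (r s (Y s ω)) ≠ ∞ := by
    rw [hupT, hνsec ω T le_rfl] at hω
    intro h
    rw [h, ENNReal.mul_top (ENNReal.ofReal_pos.2 hn0).ne'] at hω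
    exact hω.ne rfl
  have hint : IntegrableOn (fun s => r s (Y s ω)) (Ioc 0 T) :=
    (lintegral_ofReal_ne_top_iff_integrable hmeas hpos).1 hlt
  refine ⟨(intervalIntegrable_iff_integrableOn_Ioc_of_le hT0).2 hint, fun p i hi => ?_⟩
  have hu : (i * T / 2 ^ p : ℝ) ∈ Icc 0 T := by
    refine ⟨by positivity, ?_⟩
    rw [div_le_iff₀ (by positivity), mul_comm]
    gcongr
    exact_mod_cast hi
  have e : (N k ω (underGraph (fun s => ρ k s (fun u => (n : ℝ) • Y u ω)) (i * T / 2 ^ p))).toReal -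
      n * ∫ s in (0 : ℝ)..(i * T / 2 ^ p), r s (Y s ω) =
      compensated ν (N k) univ (upTo U (i * T / 2 ^ p)) ω := by
    rw [compensated, univ_inter, measureReal_def, measureReal_def, hνsec ω _ hu.2,
      hsec ω _ hu.2, ENNReal.toReal_mul, ENNReal.toReal_ofReal hn0.le,
      intervalIntegral.integral_of_le hu.1, integral_eq_lintegral_of_nonneg_ae
        (ae_restrict_of_ae_restrict_of_subset (Ioc_subset_Ioc_right hu.2) hpos)
        (hmeas.mono_set (Ioc_subset_Ioc_right hu.2))]
  rw [e]
  refine le_iSup_of_le p ?_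
  exact Finset.le_sup (f := fun i : ℕ => ‖compensated ν (N k) univ (upTo U (i * T / 2 ^ p)) ω‖ₑ)
    (Finset.mem_range.2 (by omega))

/-- The mean deviation from the fluid limit. -/
theorem IsScaledProcess.lintegral_iSup_sub_le (hT : 0 < T)
    (hX : IsScaledProcess P T ζ α n ρ F N Y) (hn : 1 ≤ n) {r : Fin m → ℝ → E → ℝ}
    {L κ : Fin m → ℝ≥0}
    (hrm : ∀ k x, Measurable fun t => r k t x)
    (hL : ∀ k, ∀ t ∈ Icc 0 T, LipschitzWith (L k) (r k t))
    (hscal : ∀ k, ∀ w : ℝ → E, IsRcll T w → ∀ t ∈ Ioc 0 T,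
      (n : ℝ) ^ (α k - 1) * ρ k t (fun u => (n : ℝ) • w u) = r k t (Function.leftLim w t))
    (hκ : ∀ k, ∫⁻ ω, ⨆ t ∈ Icc 0 T, ‖r k t (Y t ω)‖ₑ ∂P ≤ κ k)
    {Λ : ℝ → E} (hΛ : IsFluidLimit T ζ r Λ) {C : ℝ} (hC0 : 0 < C)
    (hC : ∑ k, (L k : ℝ) * ‖ζ k‖ ≤ C) :
    ∫⁻ ω, ⨆ t ∈ Icc 0 T, ‖Y t ω - Λ t‖ₑ ∂P ≤
      (∫⁻ ω, ‖Y 0 ω - Λ 0‖ₑ ∂P + ENNReal.ofReal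
        ((∑ k, 2 * √(T * κ k + 1) * ‖ζ k‖) * (n : ℝ) ^ (-(1 / 2) : ℝ))) *
        ENNReal.ofReal (Real.exp (C * T)) := by
  have hn0 : (0 : ℝ) < n := by exact_mod_cast hn
  choose S hSm hSle hS using fun k => hX.exists_dyadic_bound hT hn k (hrm k)
    (fun t ht => (hL k t ht).continuous) (hscal k) (hκ k)
  have hSfin : ∀ k, ∀ᵐ ω ∂P, S k ω < ∞ := fun k =>
    ae_lt_top' (hSm k) (ne_top_of_le_ne_top ENNReal.ofReal_ne_top (hSle k))
  have hpath : ∀ᵐ ω ∂P, ⨆ t ∈ Icc 0 T, ‖Y t ω - Λ t‖ₑ ≤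
      (‖Y 0 ω - Λ 0‖ₑ + ∑ k, ENNReal.ofReal ((n : ℝ)⁻¹ * ‖ζ k‖) * S k ω) *
        ENNReal.ofReal (Real.exp (C * T)) := by
    filter_upwards [ae_all_iff.2 hSfin, ae_all_iff.2 hS, hX.sde] with ω hfin hSω hsde
    have hreal := fun t (ht : t ∈ Icc 0 T) => norm_sub_le_of_dyadic hT hL hΛ (hX.rcll ω)
      (hX.aestronglyMeasurable_path ω) (fun k => (hSω k).1) hn0 (S := fun k => (S k ω).toReal)
      hsde (fun k p i hi => by
        have := ENNReal.toReal_mono (hfin k).ne ((hSω k).2 p i hi)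
        rwa [toReal_enorm, Real.norm_eq_abs] at this) hC0 hC ht
    refine iSup₂_le fun t ht => ?_
    have h0 : (0 : ℝ) ≤ ‖Y 0 ω - Λ 0‖ + (n : ℝ)⁻¹ * ∑ k, (S k ω).toReal * ‖ζ k‖ := by positivity
    have h1 : ‖Y t ω - Λ t‖ ≤ (‖Y 0 ω - Λ 0‖ + (n : ℝ)⁻¹ * ∑ k, (S k ω).toReal * ‖ζ k‖) *
        Real.exp (C * T) := by
      refine (hreal t ht).trans ?_
      gcongr
      exact ht.2
    rw [← ofReal_norm]
    refine (ENNReal.ofReal_le_ofReal h1).trans ?_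
    rw [ENNReal.ofReal_mul h0, ENNReal.ofReal_add (norm_nonneg _) (by positivity), ofReal_norm,
      Finset.mul_sum, ENNReal.ofReal_sum_of_nonneg fun k _ => by positivity]
    gcongr with k
    rw [mul_left_comm, mul_comm, ENNReal.ofReal_mul (by positivity),
      ENNReal.ofReal_toReal (hfin k).ne]
  refine (lintegral_mono_ae hpath).trans ?_
  rw [lintegral_mul_const' _ _ ENNReal.ofReal_ne_top]
  gcongr
  -- Only the noise term has to be measurable for this splitting.
  rw [lintegral_add_right' _ (Finset.aemeasurable_fun_sum _ fun k _ => (hSm k).const_mul _)]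
  gcongr
  rw [lintegral_finsetSum' _ fun k _ => (hSm k).const_mul _, Finset.sum_mul,
    ENNReal.ofReal_sum_of_nonneg fun k _ => by positivity]
  gcongr with k
  rw [lintegral_const_mul' _ _ ENNReal.ofReal_ne_top]
  refine (mul_le_mul_right (hSle k) _).trans ?_
  rw [← ENNReal.ofReal_mul (by positivity)]
  refine ENNReal.ofReal_le_ofReal (le_of_eq ?_)
  have h1 : (n : ℝ)⁻¹ * √n = (n : ℝ) ^ (-(1 / 2) : ℝ) := by
    rw [Real.sqrt_eq_rpow, ← Real.rpow_neg_one, ← Real.rpow_add hn0]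
    norm_num
  rw [Real.sqrt_mul hn0.le, ← h1]
  ring

end ScaledProcess

/-! ### Choice of the constants -/

theorem mainTheorem7 {Ω : Type*} [mΩ : MeasurableSpace Ω] (P : Measure Ω) [IsProbabilityMeasure P]
    (d m : ℕ) (T : ℝ) (hT : 0 < T) (ζ : Fin m → EuclideanSpace ℝ (Fin d)) (α : Fin m → ℝ)
    (ρ : ℕ → Fin m → ℝ → (ℝ → EuclideanSpace ℝ (Fin d)) → ℝ)
    (F : ℕ → Filtration ℝ mΩ) (N : ℕ → Fin m → Ω → Measure (ℝ × ℝ))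
    (X : ℕ → ℝ → Ω → EuclideanSpace ℝ (Fin d))
    (hX : ∀ n : ℕ, 1 ≤ n → IsScaledProcess P T ζ α n (ρ n) (F n) (N n) (X n))
    (r : Fin m → ℝ → EuclideanSpace ℝ (Fin d) → ℝ) (L κ : Fin m → ℝ≥0)
    (hr : LLNScaling P T α ρ r L κ X)
    (Λ : ℝ → EuclideanSpace ℝ (Fin d)) (hΛ : IsFluidLimit T ζ r Λ) :
    ∃ c : ℝ, 0 < c ∧ ∃ K : ℝ, 0 ≤ K ∧
      ((⨆ n : ℕ, ⨆ _ : 1 ≤ n, ∫⁻ ω, ‖X n 0 ω‖ₑ ∂P) < ∞ →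
        (⨆ n : ℕ, ⨆ _ : 1 ≤ n, ∫⁻ ω, ⨆ t ∈ Icc 0 T, ‖X n t ω‖ₑ ∂P)
          ≤ ENNReal.ofReal (Real.exp (c * T))) ∧
      ∀ n : ℕ, 1 ≤ n →
        ∫⁻ ω, ⨆ t ∈ Icc 0 T, ‖X n t ω - Λ t‖ₑ ∂P
          ≤ (∫⁻ ω, ‖X n 0 ω - Λ 0‖ₑ ∂P + ENNReal.ofReal (K * (n : ℝ) ^ (-(1 / 2) : ℝ)))
            * ENNReal.ofReal (Real.exp (c * T)) := by
  -- The added `1` makes the Grönwall constant positive.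
  set C : ℝ := ∑ k, (L k : ℝ) * ‖ζ k‖ + 1 with hCdef
  set K : ℝ := ∑ k, 2 * √(T * κ k + 1) * ‖ζ k‖ with hKdef
  have hC0 : 0 < C := by positivity
  have hK0 : 0 ≤ K := by positivity
  have hdev : ∀ n : ℕ, 1 ≤ n → ∀ c, C ≤ c →
      ∫⁻ ω, ⨆ t ∈ Icc 0 T, ‖X n t ω - Λ t‖ₑ ∂P
        ≤ (∫⁻ ω, ‖X n 0 ω - Λ 0‖ₑ ∂P + ENNReal.ofReal (K * (n : ℝ) ^ (-(1 / 2) : ℝ)))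
          * ENNReal.ofReal (Real.exp (c * T)) := fun n hn c hc =>
    (hX n hn).lintegral_iSup_sub_le hT hn hr.measurable hr.lipschitz (hr.scaling n hn)
      (hr.bound n hn) hΛ (hC0.trans_le hc) (by linarith)
  obtain ⟨D, hD⟩ := isCompact_Icc.exists_bound_of_continuousOn hΛ.continuousOn
  set A := ⨆ n : ℕ, ⨆ _ : 1 ≤ n, ∫⁻ ω, ‖X n 0 ω‖ₑ ∂P
  -- A bound for the mean supremum that is uniform in `n`, from the deviation estimate and `‖Λ‖ ≤
  -- D`.
  set B := (A + ‖Λ 0‖ₑ + ENNReal.ofReal K) * ENNReal.ofReal (Real.exp (C * T)) +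
    ENNReal.ofReal D with hBdef
  -- Then `exp (c * T) ≥ c * T ≥ B`. If the initial means are unbounded, `B.toReal` is `0` and `c =
  -- C`, which suffices for the deviation estimate.
  refine ⟨max C (B.toReal / T), lt_max_of_lt_left hC0, K, hK0, fun hA => ?_,
    fun n hn => hdev n hn _ (le_max_left _ _)⟩
  have hB : B ≠ ∞ := ENNReal.add_ne_top.2 ⟨ENNReal.mul_ne_top (ENNReal.add_ne_top.2
    ⟨ENNReal.add_ne_top.2 ⟨hA.ne, enorm_ne_top⟩, ENNReal.ofReal_ne_top⟩) ENNReal.ofReal_ne_top,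
    ENNReal.ofReal_ne_top⟩
  have hBexp : B ≤ ENNReal.ofReal (Real.exp (max C (B.toReal / T) * T)) := by
    rw [← ENNReal.ofReal_toReal hB]
    refine ENNReal.ofReal_le_ofReal ?_
    rw [ENNReal.toReal_ofReal ENNReal.toReal_nonneg]
    have h1 : B.toReal ≤ max C (B.toReal / T) * T := by
      rw [← div_le_iff₀ hT]
      exact le_max_right _ _
    linarith [Real.add_one_le_exp (max C (B.toReal / T) * T)]
  refine (iSup₂_le fun n hn => ?_).trans hBexp
  have h0 : ∫⁻ ω, ‖X n 0 ω - Λ 0‖ₑ ∂P ≤ A + ‖Λ 0‖ₑ := by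
    calc _ ≤ ∫⁻ ω, (‖X n 0 ω‖ₑ + ‖Λ 0‖ₑ) ∂P := lintegral_mono fun ω => enorm_sub_le
      _ = ∫⁻ ω, ‖X n 0 ω‖ₑ ∂P + ‖Λ 0‖ₑ := by
        rw [lintegral_add_right _ measurable_const]
        simp
      _ ≤ _ := by
        gcongr
        exact le_iSup₂ (f := fun n (_ : 1 ≤ n) => ∫⁻ ω, ‖X n 0 ω‖ₑ ∂P) n hn
  have hn1 : (n : ℝ) ^ (-(1 / 2) : ℝ) ≤ 1 :=
    Real.rpow_le_one_of_one_le_of_nonpos (by exact_mod_cast hn) (by norm_num)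
  calc _ ≤ ∫⁻ ω, ((⨆ t ∈ Icc 0 T, ‖X n t ω - Λ t‖ₑ) + ENNReal.ofReal D) ∂P := by
        refine lintegral_mono fun ω => iSup₂_le fun t ht => ?_
        have h1 : ‖X n t ω‖ₑ ≤ ‖X n t ω - Λ t‖ₑ + ‖Λ t‖ₑ := by
          simpa using enorm_add_le (X n t ω - Λ t) (Λ t)
        refine h1.trans (add_le_add (le_iSup₂ (f := fun t (_ : t ∈ Icc 0 T) =>
          ‖X n t ω - Λ t‖ₑ) t ht) ?_)
        rw [← ofReal_norm]
        exact ENNReal.ofReal_le_ofReal (hD t ht)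
    _ = ∫⁻ ω, (⨆ t ∈ Icc 0 T, ‖X n t ω - Λ t‖ₑ) ∂P + ENNReal.ofReal D := by
        rw [lintegral_add_right _ measurable_const]
        simp
    _ ≤ B := by
        rw [hBdef]
        gcongr
        refine (hdev n hn C le_rfl).trans ?_
        gcongr
        exact mul_le_of_le_one_right hK0 hn1
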